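/- Let $Z_2=\mathrm{Tot}(\mathcal O_{\mathbb P^1}(-2))$ be the complex surface glued from two affine planes $U$ with coordinates $(z,u)$ and $V$ with coordinates $(\xi,v)$ along $\{z\neq 0\}\cong\{\xi\neq 0\}$ by $\xi=z^{-1}$, $v=z^2u$. Let $X_2=\mathrm{Spec}\,A$ with $A=\mathbb C[x,y,w]/(y^2-xw)$ be the $A_1$ surface singularity, and let $\pi\colon Z_2\to X_2$ be the contraction of the zero section, given by $(x,y,w)=(u,zu,z^2u)$ on $U$ and $(x,y,w)=(\xi^2v,\xi v,v)$ on $V$. Let $\mathcal O(-3)$ be the line bundle on $Z_2$ with transition function $z^3$, so that a section is a pair of functions $a$ on $U$ and $b$ on $V$ with $b=z^3a$ on the overlap, and put $\mathcal F=\pi_*\mathcal O(-3)$. Let $D_{Sg}(X_2)=D^b(\mathrm{coh}\,X_2)/\mathrm{Perf}(X_2)$ be the singularity category, where $\mathrm{Perf}(X_2)$ consists of the objects isomorphic to bounded complexes of locally free sheaves of finite rank. Then: 1. $\mathcal F$ is a coherent sheaf of rank one. 2. $\mathcal F$ has an infinite periodic resolution $$\cdots\xrightarrow{\ \varphi\ }\mathcal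 O_{X_2}^{2}\xrightarrow{\ \varphi\ }\mathcal O_{X_2}^{2}\xrightarrow{\ \varphi\ }\mathcal O_{X_2}^{2}\longrightarrow\mathcal F\longrightarrow 0,\qquad \varphi=\begin{pmatrix}y&w\\-x&-y\end{pmatrix},$$ that is, the sequence is exact; all differentials are equal to $\varphi$, so in particular it is $2$-periodic. 3. $\mathcal F$ is not perfect, and its image in $D_{Sg}(X_2)$ is nonzero. 4. $\mathcal F$ generates $D_{Sg}(X_2)$: the only strictly full triangulated subcategory of $D_{Sg}(X_2)$ containing the image of $\mathcal F$ is $D_{Sg}(X_2)$ itself. -/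

import Mathlib

open CategoryTheory Limits AlgebraicGeometry TopologicalSpace

namespace A1Singularity

noncomputable section

/-- The coordinate ring of each of the two charts of `Tot 𝒪(-2)`: the variables `X 0`, `X 1` are
`z, u` on the first chart `U` and `ξ, v` on the second chart `V`. -/
abbrev P : Type := MvPolynomial (Fin 2) ℂ

/-- The coordinate ring `ℂ[z, z⁻¹, u]` of the overlap, in the coordinates of `U`. -/
abbrev Pz : Type := Localization.Away (MvPolynomial.X 0 : P)

/-- The invertible coordinate `z` on the overlap. -/
def zUnit : Pzˣ := (IsLocalization.Away.algebraMap_isUnit (S := Pz) (MvPolynomial.X 0 : P)).unit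

/-- The change of coordinates `ξ ↦ z⁻¹`, `v ↦ z² u`. -/
def transPoly : P →ₐ[ℂ] Pz :=
  MvPolynomial.aeval ![((zUnit⁻¹ : Pzˣ) : Pz), (zUnit : Pz) ^ 2 * algebraMap P Pz (MvPolynomial.X 1)]

lemma transPoly_X0 : transPoly (MvPolynomial.X 0) = ((zUnit⁻¹ : Pzˣ) : Pz) := by
  simp [transPoly]
lemma transPoly_X1 : transPoly (MvPolynomial.X 1) = (zUnit : Pz) ^ 2 * algebraMap P Pz (MvPolynomial.X 1) := by
  simp [transPoly]

lemma algebraMap_X0 : algebraMap P Pz (MvPolynomial.X 0) = (zUnit : Pz) := rfl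

/-- The extension of the change of coordinates to `ℂ[ξ, ξ⁻¹, v]`. -/
def transAux : Pz →ₐ[ℂ] Pz :=
  IsLocalization.liftAlgHom (M := Submonoid.powers (MvPolynomial.X 0 : P)) (f := transPoly) (by
    rintro ⟨_, n, rfl⟩
    simp only [map_pow, transPoly_X0]
    exact (zUnit⁻¹).isUnit.pow n)

lemma transAux_algebraMap (p : P) : transAux (algebraMap P Pz p) = transPoly p := by
  simp [transAux]

lemma transAux_z : transAux (zUnit : Pz) = ((zUnit⁻¹ : Pzˣ) : Pz) := by
  rw [← algebraMap_X0, transAux_algebraMap, transPoly_X0]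

lemma transAux_zinv : transAux ((zUnit⁻¹ : Pzˣ) : Pz) = zUnit := by
  have h : transAux ((zUnit⁻¹ : Pzˣ) : Pz) * transAux (zUnit : Pz) = 1 := by
    rw [← map_mul, Units.inv_mul, map_one]
  rw [transAux_z] at h
  exact Units.mul_inv_eq_one.1 h

lemma transAux_comp : transAux.comp transAux = AlgHom.id ℂ Pz := by
  refine IsLocalization.algHom_ext (Submonoid.powers (MvPolynomial.X 0 : P)) ?_
  refine MvPolynomial.algHom_ext fun i ↦ ?_
  change transAux (transAux (algebraMap P Pz (MvPolynomial.X i))) =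
    algebraMap P Pz (MvPolynomial.X i)
  fin_cases i
  · change transAux (transAux (algebraMap P Pz (MvPolynomial.X 0))) =
      algebraMap P Pz (MvPolynomial.X 0)
    rw [transAux_algebraMap, transPoly_X0, transAux_zinv, algebraMap_X0]
  · change transAux (transAux (algebraMap P Pz (MvPolynomial.X 1))) =
      algebraMap P Pz (MvPolynomial.X 1)
    rw [transAux_algebraMap, transPoly_X1, map_mul, map_pow, transAux_z, transAux_algebraMap,
      transPoly_X1, ← mul_assoc, ← mul_pow, Units.inv_mul, one_pow, one_mul]

/-- The change of coordinates `ξ ↦ z⁻¹`, `v ↦ z² u`, as an isomorphism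
`ℂ[ξ, ξ⁻¹, v] ≃ ℂ[z, z⁻¹, u]`. -/
def transEquiv : Pz ≃ₐ[ℂ] Pz := AlgEquiv.ofAlgHom transAux transAux transAux_comp transAux_comp

/-- The ideal `(y² - x w)` of `ℂ[x, y, w]`. -/
abbrev relIdeal : Ideal (MvPolynomial (Fin 3) ℂ) :=
  Ideal.span {MvPolynomial.X 1 ^ 2 - MvPolynomial.X 0 * MvPolynomial.X 2}

/-- The ring `ℂ[x, y, w] / (y² - x w)`. -/
abbrev A : Type := MvPolynomial (Fin 3) ℂ ⧸ relIdeal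

/-- The coordinate `x`. -/
def x : A := Ideal.Quotient.mk relIdeal (MvPolynomial.X 0)

/-- The coordinate `y`. -/
def y : A := Ideal.Quotient.mk relIdeal (MvPolynomial.X 1)

/-- The coordinate `w`. -/
def w : A := Ideal.Quotient.mk relIdeal (MvPolynomial.X 2)

/-- The contraction on `U`: `x ↦ u`, `y ↦ z u`, `w ↦ z² u`. -/
def contractU : A →ₐ[ℂ] P :=
  Ideal.Quotient.liftₐ relIdeal
    (MvPolynomial.aeval ![MvPolynomial.X 1, MvPolynomial.X 0 * MvPolynomial.X 1,
      MvPolynomial.X 0 ^ 2 * MvPolynomial.X 1]) (by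
    intro a ha
    rw [← RingHom.mem_ker]
    revert a
    rw [← SetLike.le_def, Ideal.span_singleton_le_iff_mem, RingHom.mem_ker]
    simp
    ring)

/-- The contraction on `V`: `x ↦ ξ² v`, `y ↦ ξ v`, `w ↦ v`. -/
def contractV : A →ₐ[ℂ] P :=
  Ideal.Quotient.liftₐ relIdeal
    (MvPolynomial.aeval ![MvPolynomial.X 0 ^ 2 * MvPolynomial.X 1,
      MvPolynomial.X 0 * MvPolynomial.X 1, MvPolynomial.X 1]) (by
    intro a ha
    rw [← RingHom.mem_ker]
    revert a
    rw [← SetLike.le_def, Ideal.span_singleton_le_iff_mem, RingHom.mem_ker]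
    simp
    ring)

lemma contractU_x : contractU x = MvPolynomial.X 1 := by
  exact MvPolynomial.aeval_X (R := ℂ) _ (0 : Fin 3)

lemma contractU_y : contractU y = MvPolynomial.X 0 * MvPolynomial.X 1 := by
  exact MvPolynomial.aeval_X (R := ℂ) _ (1 : Fin 3)

lemma contractU_w : contractU w = MvPolynomial.X 0 ^ 2 * MvPolynomial.X 1 := by
  exact MvPolynomial.aeval_X (R := ℂ) _ (2 : Fin 3)

lemma contractV_x : contractV x = MvPolynomial.X 0 ^ 2 * MvPolynomial.X 1 := by
  exact MvPolynomial.aeval_X (R := ℂ) _ (0 : Fin 3)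

lemma contractV_y : contractV y = MvPolynomial.X 0 * MvPolynomial.X 1 := by
  exact MvPolynomial.aeval_X (R := ℂ) _ (1 : Fin 3)

lemma contractV_w : contractV w = MvPolynomial.X 1 := by
  exact MvPolynomial.aeval_X (R := ℂ) _ (2 : Fin 3)

/-- An affine chart of `Tot 𝒪(-2)`, isomorphic to the affine plane. -/
abbrev chart : Scheme.{0} := Spec (.of P)

/-- The overlap of the two charts. -/
abbrev overlap : Scheme.{0} := Spec (.of Pz)

/-- The `A₁` surface singularity `Spec ℂ[x, y, w] / (y² - x w)`. -/
abbrev X₂ : Scheme.{0} := Spec (.of A)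

/-- The inclusion of the overlap into `U`. -/
def overlapToU : overlap ⟶ chart := Spec.map (CommRingCat.ofHom (algebraMap P Pz))

/-- The inclusion of the overlap into `V`. -/
def overlapToV : overlap ⟶ chart :=
  Spec.map (CommRingCat.ofHom (transEquiv : Pz →+* Pz)) ≫
    Spec.map (CommRingCat.ofHom (algebraMap P Pz))

instance : IsOpenImmersion overlapToU :=
  IsOpenImmersion.of_isLocalization (MvPolynomial.X 0 : P)

instance : IsOpenImmersion overlapToV := by
  have : IsIso (CommRingCat.ofHom (transEquiv : Pz →+* Pz)) :=
    (transEquiv.toRingEquiv.toCommRingCatIso).isIso_hom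
  have : IsOpenImmersion (Spec.map (CommRingCat.ofHom (algebraMap P Pz))) :=
    IsOpenImmersion.of_isLocalization (MvPolynomial.X 0 : P)
  unfold overlapToV
  infer_instance

/-- The surface `Tot 𝒪(-2)` over the projective line, glued from its two charts. -/
def Z₂ : Scheme.{0} := pushout overlapToU overlapToV

/-- The chart `U`. -/
def ιU : chart ⟶ Z₂ := pushout.inl _ _

/-- The chart `V`. -/
def ιV : chart ⟶ Z₂ := pushout.inr _ _

lemma ι_condition : overlapToV ≫ ιV = overlapToU ≫ ιU := pushout.condition.symm

lemma contract_condition : overlapToU ≫ Spec.map (CommRingCat.ofHom (contractU : A →+* P)) =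
    overlapToV ≫ Spec.map (CommRingCat.ofHom (contractV : A →+* P)) := by
  have key : (Algebra.algHom ℂ P Pz).comp contractU = 
     (transEquiv : Pz →ₐ[ℂ] Pz).comp ((Algebra.algHom ℂ P Pz).comp contractV) := by
    refine Ideal.Quotient.algHom_ext _ (MvPolynomial.algHom_ext fun i ↦ ?_)
    change algebraMap P Pz (contractU (Ideal.Quotient.mk relIdeal (MvPolynomial.X i))) =
      transAux (algebraMap P Pz (contractV (Ideal.Quotient.mk relIdeal (MvPolynomial.X i))))
    rw [transAux_algebraMap]
    have h0 : ((zUnit⁻¹ : Pzˣ) : Pz) * (zUnit : Pz) = 1 := zUnit.inv_mul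
    fin_cases i
    · change algebraMap P Pz (contractU x) = transPoly (contractV x)
      rw [contractU_x, contractV_x, map_mul, map_pow, transPoly_X0, transPoly_X1, ← mul_assoc,
        ← mul_pow, h0, one_pow, one_mul]
    · change algebraMap P Pz (contractU y) = transPoly (contractV y)
      rw [contractU_y, contractV_y, map_mul, map_mul, transPoly_X0, transPoly_X1, ← mul_assoc,
        pow_two, ← mul_assoc, h0, one_mul, algebraMap_X0]
    · change algebraMap P Pz (contractU w) = transPoly (contractV w)
      rw [contractU_w, contractV_w, map_mul, map_pow, transPoly_X1, algebraMap_X0]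
  simp only [overlapToU, overlapToV, ← Spec.map_comp]
  congr 1
  exact CommRingCat.hom_ext (congrArg AlgHom.toRingHom key)

/-- The contraction of the zero section of `Tot 𝒪(-2)`. -/
def π : Z₂ ⟶ X₂ := pushout.desc _ _ contract_condition

/-- The structure sheaf as a sheaf of modules. -/
abbrev 𝒪 (X : Scheme.{0}) : X.Modules := SheafOfModules.unit X.ringCatSheaf

/-- The map `𝒪_Y ⟶ f_* 𝒪_X` given by pulling back functions along `f`. -/
def structureMap {X Y : Scheme.{0}} (f : X ⟶ Y) : 𝒪 Y ⟶ (Scheme.Modules.pushforward f).obj (𝒪 X) :=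
  SheafOfModules.unitToPushforwardObjUnit f.toRingCatSheafHom

/-- Restriction of functions from `U` to the overlap. -/
def resU : (Scheme.Modules.pushforward ιU).obj (𝒪 chart) ⟶
    (Scheme.Modules.pushforward (overlapToU ≫ ιU)).obj (𝒪 overlap) :=
  (Scheme.Modules.pushforward ιU).map (structureMap overlapToU) ≫
    (Scheme.Modules.pushforwardComp overlapToU ιU).hom.app (𝒪 overlap)

/-- Restriction of functions from `V` to the overlap. -/
def resV : (Scheme.Modules.pushforward ιV).obj (𝒪 chart) ⟶
    (Scheme.Modules.pushforward (overlapToU ≫ ιU)).obj (𝒪 overlap) :=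
  (Scheme.Modules.pushforward ιV).map (structureMap overlapToV) ≫
    (Scheme.Modules.pushforwardComp overlapToV ιV).hom.app (𝒪 overlap) ≫
    (Scheme.Modules.pushforwardCongr ι_condition).hom.app (𝒪 overlap)

/-- Multiplication by the global function `r` on the structure sheaf of `Spec R`. -/
def mulO {R : CommRingCat.{0}} (r : R) : 𝒪 (Spec R) ⟶ 𝒪 (Spec R) :=
  tildeSelf.inv ≫ tilde.map (ModuleCat.ofHom (LinearMap.mulLeft R r)) ≫ tildeSelf.hom

/-- The line bundle `𝒪(-3)` on `Tot 𝒪(-2)`, with transition function `z³`: a section is a pair of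
functions `a` on `U` and `b` on `V` such that `z³ a = b` on the overlap. -/
def L : Z₂.Modules :=
  pullback (resU ≫ (Scheme.Modules.pushforward (overlapToU ≫ ιU)).map
    (mulO ((zUnit : Pz) ^ 3))) resV

/-- The direct image of `𝒪(-3)` on the singular surface. -/
def F : X₂.Modules := (Scheme.Modules.pushforward π).obj L

/-- Coherent sheaves on a locally Noetherian scheme: the quasi-coherent sheaves of finite type. -/
def isCoherent (X : Scheme.{0}) : ObjectProperty X.Modules :=
  fun F ↦ F.IsQuasicoherent ∧ F.IsFiniteType

section Coherent

variable {R : CommRingCat.{0}}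

lemma isFiniteType_tilde (M : ModuleCat.{0} R) [h : Module.Finite R M] :
    (tilde M).IsFiniteType := by
  obtain ⟨s, hs⟩ := h.fg_top
  let p := presentationTilde M (s : Set M) hs _ (Submodule.span_eq _)
  have hp : Finite p.generators.I := inferInstanceAs (Finite (s : Set M))
  let q : (tilde M).LocalGeneratorsData := p.generators.localGeneratorsData
  have hq : ∀ i, (q.generators i).IsFiniteType := fun i ↦ ⟨hp⟩
  exact SheafOfModules.IsFiniteType.mk.{0} ⟨q, ⟨hq⟩⟩

lemma finite_of_generatingSections (F : (Spec R).Modules) (hF : F.IsQuasicoherent)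
    (G : F.GeneratingSections) (hG : G.IsFiniteType) :
    Module.Finite R ((moduleSpecΓFunctor (R := R)).obj F) := by
  let N := (moduleSpecΓFunctor (R := R)).obj F
  have hi : IsIso F.fromTildeΓ := (isQuasicoherent_iff_isIso_fromTildeΓ F).1 hF
  let e : (tilde.functor R).obj N ≅ F := @asIso _ _ _ _ F.fromTildeΓ hi
  let fr : (Spec R).Modules := SheafOfModules.free G.I
  let t : (tilde.functor R).obj (ModuleCat.of R (G.I →₀ R)) ≅ fr := tildeFinsupp G.I
  let p : fr ⟶ F := G.π
  let φ : ModuleCat.of R (G.I →₀ R) ⟶ N :=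
    (tilde.functor R).preimage (t.hom ≫ p ≫ e.inv)
  have h1 : (tilde.functor R).map φ = t.hom ≫ p ≫ e.inv :=
    Functor.map_preimage _ _
  have h2 : Epi ((tilde.functor R).map φ) := by
    rw [h1]
    have b : Epi p := G.epi
    exact @epi_comp _ _ _ _ _ _ inferInstance _ (@epi_comp _ _ _ _ _ _ b _ inferInstance)
  have : Epi φ := (tilde.functor R).epi_of_epi_map h2
  have hs := (ModuleCat.epi_iff_surjective φ).1 this
  have := hG.finite
  have : Module.Finite R (G.I →₀ R) := inferInstance
  exact Module.Finite.of_surjective φ.hom hs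

lemma isQuasicoherent_restrict {X Y : Scheme.{0}} (f : X ⟶ Y) [IsOpenImmersion f] (M : Y.Modules)
    (hM : M.IsQuasicoherent) : (M.restrict f).IsQuasicoherent :=
  @Scheme.Modules.isQuasicoherent_restrictFunctor _ _ f _ M hM

/-- Restriction of generating sections to a smaller open subscheme. -/
def restrictGenerators {X Y : Scheme.{0}} (M : X.Modules) (W : X.Opens) (f : Y ⟶ X)
    [IsOpenImmersion f] (h : f.opensRange ≤ W) (G : (M.over W).GeneratingSections) :
    (M.restrict f).GeneratingSections := by
  let u : Y ⟶ W.toScheme := IsOpenImmersion.lift W.ι f (by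
    simpa [← SetLike.coe_subset_coe] using h)
  have hu : u ≫ W.ι = f := IsOpenImmersion.lift_fac ..
  have : IsOpenImmersion u := by
    have : IsOpenImmersion (u ≫ W.ι) := by rw [hu]; infer_instance
    exact IsOpenImmersion.of_comp u W.ι
  have : PreservesColimitsOfSize.{0, 0} (Scheme.Modules.restrictFunctor u) := inferInstance
  let F := (Scheme.Modules.overEquiv W).functor ⋙ Scheme.Modules.restrictFunctor u
  let iso : SheafOfModules.overFunctor X.ringCatSheaf _ ⋙ F ≅ Scheme.Modules.restrictFunctor f :=
    (Functor.associator _ _ _).symm ≪≫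
        Functor.isoWhiskerRight (Scheme.Modules.overFunctorEquiv _) _ ≪≫
        (Scheme.Modules.restrictFunctorComp _ _).symm ≪≫ (Scheme.Modules.restrictFunctorCongr hu)
  have hF : PreservesColimitsOfSize.{0, 0} F :=
    comp_preservesColimits _ _
  let G' : SheafOfModules.GeneratingSections (F.obj (M.over W)) :=
    @SheafOfModules.GeneratingSections.map _ _ _ _ _ _ _ _ _ _ _ _ _ G F hF
      (Scheme.Modules.restrictUnitIso _).symm
  exact @SheafOfModules.GeneratingSections.ofEpi _ _ _ _ _ _ _ _ G' (iso.app M).hom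
    (show Epi (iso.app M).hom from inferInstance)

instance isOpenImmersion_away (a : R) : IsOpenImmersion
    (Spec.map (CommRingCat.ofHom (algebraMap R (Localization.Away a)))) :=
  IsOpenImmersion.of_isLocalization a

lemma exists_finset_of_finite_localization {R S M Q N : Type*} [CommRing R] [CommRing S] (a : R)
    [Algebra R S] [IsLocalization.Away a S]
    [AddCommGroup M] [Module R M] [AddCommGroup Q] [Module R Q] (ρ : M →ₗ[R] Q)
    [IsLocalizedModule (.powers a) ρ] [AddCommGroup N] [Module S N]
    [hN : Module.Finite S N] (e : N ≃+ Q)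
    (he : ∀ (r : R) (n : N), e (algebraMap R S r • n) = r • e n) :
    ∃ s : Finset M, ∀ m : M, ∃ k : ℕ, a ^ k • m ∈ Submodule.span R (s : Set M) := by
  let _ : Module R N := Module.compHom N (algebraMap R S)
  have : IsScalarTower R S N := .of_algebraMap_smul fun _ _ ↦ rfl
  let e' : Q ≃ₗ[R] N := ({ e with map_smul' := he } : N ≃ₗ[R] Q).symm
  have hf : IsLocalizedModule (.powers a) (e'.toLinearMap ∘ₗ ρ) :=
    IsLocalizedModule.of_linearEquiv _ _ _
  obtain ⟨s, hs⟩ := hN.fg_top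
  classical
  refine ⟨IsLocalizedModule.finsetIntegerMultiple (.powers a) (e'.toLinearMap ∘ₗ ρ) s, fun m ↦ ?_⟩
  obtain ⟨⟨_, n₁, rfl⟩, hn₁⟩ := multiple_mem_span_of_mem_localization_span (.powers a)
    S (s : Set N)
    (IsLocalizedModule.mk' (e'.toLinearMap ∘ₗ ρ) m (1 : Submonoid.powers a)) (by rw [hs]; trivial)
  rw [Submonoid.smul_def, ← IsLocalizedModule.mk'_smul, IsLocalizedModule.mk'_one] at hn₁
  obtain ⟨⟨_, n₂, rfl⟩, hn₂⟩ := IsLocalizedModule.smul_mem_finsetIntegerMultiple_span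
    (.powers a) (e'.toLinearMap ∘ₗ ρ) _ s hn₁
  rw [Submonoid.smul_def] at hn₂
  refine ⟨n₂ + n₁, ?_⟩
  rw [pow_add, mul_smul]
  exact hn₂

/-- The localization `R_a`. -/
def awayRing (R : CommRingCat.{0}) (a : R) : CommRingCat.{0} := .of (Localization.Away a)

/-- The localization map `R ⟶ R_a`. -/
def awayMap (R : CommRingCat.{0}) (a : R) : R ⟶ awayRing R a :=
  CommRingCat.ofHom (algebraMap R (Localization.Away a))

instance (a : R) : Algebra R (awayRing R a) := inferInstanceAs (Algebra R (Localization.Away a))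
instance (a : R) : IsLocalization.Away a (awayRing R a) :=
  inferInstanceAs (IsLocalization.Away a (Localization.Away a))

instance (a : R) : IsOpenImmersion (Spec.map (awayMap R a)) :=
  isOpenImmersion_away a

/-- The basic open subset of `Spec R` where `a` does not vanish. -/
def dopen (a : R) : (Spec R).Opens := PrimeSpectrum.basicOpen a

lemma image_awayMap (a : R) : Spec.map (awayMap R a) ''ᵁ ⊤ = dopen a := by
  refine TopologicalSpace.Opens.ext ?_
  simp only [awayMap, Scheme.Hom.image_top_eq_opensRange, Scheme.Hom.coe_opensRange]
  exact PrimeSpectrum.localization_away_comap_range (Localization.Away a) a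

/-- The global sections of a sheaf of modules on `Spec R`. -/
abbrev secTop (F : (Spec R).Modules) : Type := Γ(F, (⊤ : (Spec R).Opens))

/-- The sections of a sheaf of modules over the locus where `a` does not vanish. -/
abbrev secD (F : (Spec R).Modules) (a : R) : Type := Γ(F, dopen a)

/-- Global sections of the restriction to `Spec R_a` are sections over the basic open subset. -/
def sectionsAway (F : (Spec R).Modules) (a : R) :
    secTop (F.restrict (Spec.map (awayMap R a))) ≃+ secD F a :=
  ((F.restrictAppIso (Spec.map (awayMap R a)) ⊤) ≪≫
      F.presheaf.mapIso (eqToIso (image_awayMap a).symm).op).addCommGroupIsoToAddEquiv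

lemma sectionsAway_smul (F : (Spec R).Modules) (a r : R)
    (n : secTop (F.restrict (Spec.map (awayMap R a)))) :
    sectionsAway F a (awayMap R a r • n) = r • sectionsAway F a n := by
  have h1 := Scheme.Modules.restrictAppIso_smul_Spec (M := F) (awayMap R a) (U := ⊤) r n
  have h2 := Scheme.Modules.map_smul_Spec (M := F) (eqToHom (image_awayMap a).symm).op r
    ((F.restrictAppIso (Spec.map (awayMap R a)) ⊤).hom n)
  exact (congrArg (F.presheaf.map (eqToHom (image_awayMap a).symm).op) h1).trans h2

lemma exists_finset_of_restrict (F : (Spec R).Modules) (hF : F.IsQuasicoherent) (a : R)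
    (h : Module.Finite (awayRing R a) (secTop (F.restrict (Spec.map (awayMap R a))))) :
    ∃ s : Finset (secTop F), ∀ m, ∃ k : ℕ,
      a ^ k • m ∈ Submodule.span R (s : Set (secTop F)) := by
  have hloc := (isIso_fromTildeΓ_iff_isLocalizing F).1
    ((isQuasicoherent_iff_isIso_fromTildeΓ F).1 hF) a
  exact @exists_finset_of_finite_localization R (awayRing R a) (secTop F) (secD F a)
    (secTop (F.restrict (Spec.map (awayMap R a)))) _ _ a _ _ _ _ _ _ _ hloc _ _ h
      (sectionsAway F a) (sectionsAway_smul F a)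

lemma finite_restrict (F : (Spec R).Modules) (hF : F.IsQuasicoherent)
    (W : (Spec R).Opens) (G : (F.over W).GeneratingSections) (hG : G.IsFiniteType) (a : R)
    (h : dopen a ≤ W) :
    Module.Finite (awayRing R a) (secTop (F.restrict (Spec.map (awayMap R a)))) := by
  have h' : (Spec.map (awayMap R a)).opensRange ≤ W := by
    rw [← Scheme.Hom.image_top_eq_opensRange, image_awayMap]; exact h
  let G' := restrictGenerators F W (Spec.map (awayMap R a)) h' G
  have hG' : G'.IsFiniteType := ⟨hG.finite⟩
  exact finite_of_generatingSections _ (isQuasicoherent_restrict _ F hF) G' hG'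

lemma finite_of_isCoherent (F : (Spec R).Modules) (hF : isCoherent _ F) :
    Module.Finite R (secTop F) := by
  obtain ⟨hq, ⟨q, hq'⟩⟩ := hF
  have hq' := hq'.isFiniteType
  let t : Set R := {a | ∃ i, dopen a ≤ q.X i}
  have ht : Ideal.span t = ⊤ := by
    rw [← PrimeSpectrum.zeroLocus_empty_iff_eq_top, PrimeSpectrum.zeroLocus_span,
      Set.eq_empty_iff_forall_notMem]
    intro p hp
    have hc : IsOpenCover q.X := (Opens.coversTop_iff _ _).1 q.coversTop
    obtain ⟨i, hi⟩ := hc.exists_mem p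
    obtain ⟨_, ⟨_, ⟨r, rfl⟩, rfl⟩, hxr, hrU⟩ :=
      PrimeSpectrum.isBasis_basic_opens.exists_subset_of_mem_open hi (q.X i).2
    exact hxr (hp ⟨i, hrU⟩)
  obtain ⟨t', ht', h1⟩ := (Ideal.span_eq_top_iff_finite t).1 ht
  have key : ∀ a : t', ∃ s : Finset (secTop F), ∀ m, ∃ k : ℕ,
      (a : R) ^ k • m ∈ Submodule.span R (s : Set (secTop F)) := by
    rintro ⟨a, ha⟩
    obtain ⟨i, hi⟩ := ht' ha
    exact exists_finset_of_restrict F hq a (finite_restrict F hq _ (q.generators i) (hq' i) a hi)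
  choose s hs using key
  classical
  refine ⟨⟨Finset.univ.biUnion s, ?_⟩⟩
  rw [eq_top_iff]
  rintro m -
  refine Submodule.mem_of_span_eq_top_of_smul_pow_mem _ (t' : Set R) h1 m ?_
  intro a
  obtain ⟨k, hk⟩ := hs a m
  exact ⟨k, Submodule.span_mono (by
    intro z hz; exact Finset.mem_biUnion.2 ⟨a, Finset.mem_univ _, hz⟩) hk⟩
/-- The category of coherent sheaves on `Spec R`. -/
abbrev Coh (R : CommRingCat.{0}) : Type 1 := (isCoherent (Spec R)).FullSubcategory

lemma isCoherent_tilde (M : ModuleCat.{0} R) [Module.Finite R M] : isCoherent (Spec R) (tilde M) :=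
  ⟨show (tilde M).IsQuasicoherent from inferInstance, isFiniteType_tilde M⟩

/-- The functor sending a finitely generated module to the associated coherent sheaf. -/
def tildeFG (R : CommRingCat.{0}) : FGModuleCat.{0} R ⥤ Coh R :=
  ObjectProperty.lift _ ((ModuleCat.isFG.{0} R).ι ⋙ tilde.functor R) fun M ↦
    @isCoherent_tilde R M.obj M.property

instance : (tildeFG R).Full where
  map_surjective {M N} f := by
    obtain ⟨g, hg⟩ := (tilde.functor R).map_surjective (X := M.obj) (Y := N.obj) f.hom
    exact ⟨ObjectProperty.homMk g, ObjectProperty.hom_ext _ hg⟩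

instance : (tildeFG R).Faithful where
  map_injective h :=
    ObjectProperty.hom_ext _ ((tilde.functor R).map_injective
      (congrArg (fun k ↦ k.hom) h))

instance : (tildeFG R).EssSurj where
  mem_essImage F := by
    have h : IsIso F.obj.fromTildeΓ := (isQuasicoherent_iff_isIso_fromTildeΓ F.obj).1 F.property.1
    let N : FGModuleCat R := ⟨(moduleSpecΓFunctor (R := R)).obj F.obj,
      finite_of_isCoherent F.obj F.property⟩
    exact ⟨N, ⟨(isCoherent (Spec R)).isoMk (@asIso _ _ _ _ F.obj.fromTildeΓ h)⟩⟩

instance : (tildeFG R).IsEquivalence where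

instance [IsNoetherianRing R] : HasFiniteProducts (Coh R) :=
  ⟨fun _ ↦ Adjunction.hasLimitsOfShape_of_equivalence (tildeFG R).inv⟩

instance [IsNoetherianRing R] : Abelian (Coh R) :=
  abelianOfEquivalence (tildeFG R).inv

lemma exists_isZero_isLocallyFree (R : CommRingCat.{0}) :
    ∃ G : Coh R, IsZero G ∧ SheafOfModules.IsLocallyFree G.obj := by
  let Z : (Spec R).Modules := SheafOfModules.free PEmpty.{1}
  let g : Z.GeneratingSections := SheafOfModules.free.generatingSections PEmpty.{1}
  let q : Z.LocalGeneratorsData := g.localGeneratorsData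
  have hq : ∀ i, (q.generators i).IsFiniteType := fun i ↦ ⟨inferInstanceAs (Finite PEmpty.{1})⟩
  have h1 : Z.IsLocallyFree :=
    inferInstanceAs (SheafOfModules.free (R := (Spec R).ringCatSheaf) PEmpty.{1}).IsLocallyFree
  have h2 : Z.IsFiniteType := SheafOfModules.IsFiniteType.mk.{0} ⟨q, ⟨hq⟩⟩
  have h3 : Z.IsQuasicoherent := inferInstance
  refine ⟨⟨Z, h3, h2⟩, (IsZero.iff_id_eq_zero _).2 (ObjectProperty.hom_ext _ ?_), h1⟩
  exact (SheafOfModules.freeHomEquiv Z).injective (funext fun i ↦ i.elim)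

section Derived

variable (R) [IsNoetherianRing R]

instance : HasDerivedCategory (Coh R) := HasDerivedCategory.standard (Coh R)

/-- The bounded derived category of coherent sheaves on `Spec R`. -/
abbrev Db : Type 1 := DerivedCategory.Bounded (Coh R)

/-- A bounded complex of coherent sheaves is perfect if it is isomorphic in the derived category to
a bounded complex of locally free sheaves of finite rank. -/
def isPerfect : ObjectProperty (Db R) := fun K ↦
  ∃ P : CochainComplex (Coh R) ℤ,
    (∃ a b : ℤ, P.IsStrictlyGE a ∧ P.IsStrictlyLE b) ∧
    (∀ n, SheafOfModules.IsLocallyFree (P.X n).obj) ∧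
    Nonempty (K.obj ≅ DerivedCategory.Q.obj P)

variable {R} in
/-- A coherent sheaf, as a complex concentrated in degree zero. -/
def inDb (G : Coh R) : Db R :=
  ⟨(DerivedCategory.singleFunctor (Coh R) 0).obj G, ⟨⟨0, inferInstance⟩, ⟨0, inferInstance⟩⟩⟩

instance : (isPerfect R).Nonempty := by
  obtain ⟨G, hG, hG'⟩ := exists_isZero_isLocallyFree R
  let P : CochainComplex (Coh R) ℤ := { X := fun _ ↦ G, d := fun _ _ ↦ 0 }
  have hP : IsZero P := (IsZero.iff_id_eq_zero _).2
    (HomologicalComplex.hom_ext _ _ fun _ ↦ hG.eq_of_src _ _)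
  have h1 : P.IsStrictlyGE 0 := (CochainComplex.isStrictlyGE_iff _ _).2 fun _ _ ↦ hG
  have h2 : P.IsStrictlyLE 0 := (CochainComplex.isStrictlyLE_iff _ _).2 fun _ _ ↦ hG
  exact ⟨⟨inDb G, P, ⟨0, 0, h1, h2⟩, fun _ ↦ hG', ⟨IsZero.iso
    ((DerivedCategory.singleFunctor (Coh R) 0).map_isZero hG) (DerivedCategory.Q.map_isZero hP)⟩⟩⟩

/-- The singularity category of `Spec R`: the Verdier quotient of the bounded derived category of
coherent sheaves by the thick subcategory of perfect complexes. -/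
abbrev DSg : Type 1 := (isPerfect R).triangEnvelope.trW.Localization

variable {R} in
/-- The image of a coherent sheaf in the singularity category. -/
def inDSg (G : Coh R) : DSg R := (isPerfect R).triangEnvelope.trW.Q.obj (inDb G)

end Derived

end Coherent

/-- An object of a triangulated category generates it if every strictly full triangulated
subcategory that contains the object is the whole category. -/
def Generates {C : Type*} [Category C] [HasZeroObject C] [HasShift C ℤ] [Preadditive C]
    [∀ n : ℤ, (shiftFunctor C n).Additive] [Pretriangulated C] (X : C) : Prop :=
  ∀ T : ObjectProperty C, T.IsTriangulated → T.IsClosedUnderIsomorphisms → T X → T = ⊤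

/-- The free sheaf of rank two on `X₂`. -/
def O₂ : X₂.Modules := tilde (ModuleCat.of (CommRingCat.of A) (Fin 2 → A))

/-- The endomorphism of the free sheaf of rank two given by the matrix with rows `(y, w)` and
`(-x, -y)`. -/
def φ : O₂ ⟶ O₂ :=
  tilde.map (ModuleCat.ofHom (R := CommRingCat.of A) (Matrix.mulVecLin !![y, w; -x, -y]))

/-- The rank of a sheaf on `X₂`: the rank of its global sections over the domain `A`. -/
def rank (G : X₂.Modules) : Cardinal.{0} :=
  Module.rank A ((moduleSpecΓFunctor (R := CommRingCat.of A)).obj G)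

end

end A1Singularity

/-!
`A` is the ring of even polynomials in `ℂ[s, t]`, with `x = s²`, `y = st`, `w = t²`. On `U`,
the global sections of `F` are the polynomials in the monomials `zⁱ uʲ` with `i + 3 ≤ 2 j`. They
form `u · (x, y)`, so `F` is the sheaf of the ideal `(x, y)`, which is isomorphic to the module of
odd polynomials. Since `φ² = 0` is a matrix factorization with cokernel `(x, y)`, there is an exact
sequence `0 → F → O² → F → 0`; as `(x, y)` is not projective, no syzygy of `F` is, and `F` is not
perfect.

Generation is a dévissage. A prime of `A` lies under a prime of `ℂ[s, t]`; if that prime is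
principal, the prime of `A` is free or isomorphic to `(x, y)`. A maximal ideal is a point of the
cone, which lies on a line through the origin; the ideal of this line is such a prime, and the
residue field of the point is the cokernel of an injective endomorphism of the quotient by it.
-/

namespace A1Singularity

noncomputable section

section Tilde

universe u

variable {R : CommRingCat.{u}}

lemma tilde_map_app_injective {M N : ModuleCat.{u} R} (f : M ⟶ N) (hf : Function.Injective f)
    (U : (Spec R).Opens) : Function.Injective ((tilde.map f).app U) := fun _ _ h ↦
  Subtype.ext <| funext fun p ↦
    LocalizedModule.map_injective _ f.hom hf (congrFun (congrArg Subtype.val h) p)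

instance : (tilde.functor R).PreservesMonomorphisms where
  preserves {M N} f hf := by
    let α := (Scheme.Modules.toPresheaf _).map ((tilde.functor R).map f)
    have (U : (Opens (Spec R))ᵒᵖ) : Mono (α.app U) := (AddCommGrpCat.mono_iff_injective _).2
      (tilde_map_app_injective f ((ModuleCat.mono_iff_injective f).1 hf) U.unop)
    have : Mono α := NatTrans.mono_of_mono_app α
    exact (Scheme.Modules.toPresheaf _).mono_of_mono_map this

instance : (tilde.functor R).PreservesHomology :=
  ((tilde.functor R).exact_tfae.out 0 2).1 fun S hS ↦ by
    have := hS.mono_f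
    obtain ⟨exact_map, epi_map⟩ :=
      ((tilde.functor R).preservesFiniteColimits_iff_forall_exact_map_and_epi).1 inferInstance S hS
    exact { exact := exact_map
            mono_f := inferInstanceAs (Mono ((tilde.functor R).map S.f))
            epi_g := epi_map }

instance : PreservesFiniteLimits (tilde.functor R) :=
  (tilde.functor R).preservesFiniteLimits_of_preservesHomology

instance (J : Type) [SmallCategory J] [FinCategory J] :
    (SheafOfModules.isQuasicoherent (Spec R).ringCatSheaf).IsClosedUnderLimitsOfShape J :=
  essImage_tilde (R := R) ▸
    (inferInstance : (tilde.functor R).essImage.IsClosedUnderLimitsOfShape J)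

lemma isQuasicoherent_pullback {M M' N : (Spec R).Modules} (f : M ⟶ N) (g : M' ⟶ N)
    [M.IsQuasicoherent] [M'.IsQuasicoherent] [N.IsQuasicoherent] :
    (pullback f g).IsQuasicoherent := by
  refine (SheafOfModules.isQuasicoherent (Spec R).ringCatSheaf).prop_limit (cospan f g) ?_
  rintro (_ | _ | _) <;> assumption

lemma isQuasicoherent_of_iso {X : Scheme.{u}} {M N : X.Modules} (e : M ≅ N)
    [hM : M.IsQuasicoherent] : N.IsQuasicoherent :=
  (SheafOfModules.isQuasicoherent X.ringCatSheaf).prop_of_iso e hM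

lemma isQuasicoherent_pushforward {S : CommRingCat.{u}} (f : R ⟶ S) (M : (Spec S).Modules)
    [M.IsQuasicoherent] : ((Scheme.Modules.pushforward (Spec.map f)).obj M).IsQuasicoherent :=
  (isQuasicoherent_iff_isIso_fromTildeΓ _).2 (isIso_fromTildeΓ_pushforward f M)

lemma isQuasicoherent_pushforward_pushforward {X : Scheme.{u}} {S : CommRingCat.{u}}
    (i : Spec S ⟶ X) (p : X ⟶ Spec R) (f : R ⟶ S) (h : i ≫ p = Spec.map f)
    (M : (Spec S).Modules) [M.IsQuasicoherent] :
    ((Scheme.Modules.pushforward p).obj ((Scheme.Modules.pushforward i).obj M)).IsQuasicoherent :=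
  have := isQuasicoherent_pushforward f M
  isQuasicoherent_of_iso ((Scheme.Modules.pushforwardCongr h).symm.app M ≪≫
    (Scheme.Modules.pushforwardComp i p).symm.app M)

/-- A quasi-coherent sheaf on `Spec R` is associated with any module isomorphic to its module of
global sections. -/
def tildeIso (G : (Spec R).Modules) [G.IsQuasicoherent] {N : ModuleCat.{u} R}
    (e : N ≅ (moduleSpecΓFunctor (R := R)).obj G) : tilde N ≅ G :=
  (tilde.functor R).mapIso e ≪≫
    @asIso _ _ _ _ G.fromTildeΓ ((isQuasicoherent_iff_isIso_fromTildeΓ G).1 inferInstance)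

lemma exists_periodic_resolution {M N : ModuleCat.{u} R} {G : (Spec R).Modules}
    (e : tilde N ≅ G) (f : M ⟶ M) (g : M ⟶ N)
    (hff : Function.Exact f f) (hfg : Function.Exact f g) (hg : Function.Surjective g) :
    ∃ (p : tilde M ⟶ G) (h₀ : tilde.map f ≫ p = 0) (h₁ : tilde.map f ≫ tilde.map f = 0),
      Epi p ∧ (ShortComplex.mk _ _ h₀).Exact ∧ (ShortComplex.mk _ _ h₁).Exact := by
  let S₀ := ShortComplex.mk f g (ModuleCat.hom_ext (LinearMap.ext hfg.apply_apply_eq_zero))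
  let S₁ := ShortComplex.mk f f (ModuleCat.hom_ext (LinearMap.ext hff.apply_apply_eq_zero))
  have exact₀ : (S₀.map (tilde.functor R)).Exact :=
    ((ShortComplex.ShortExact.moduleCat_exact_iff_function_exact S₀).2 hfg).map _
  have exact₁ : (S₁.map (tilde.functor R)).Exact :=
    ((ShortComplex.ShortExact.moduleCat_exact_iff_function_exact S₁).2 hff).map _
  have : Epi g := (ModuleCat.epi_iff_surjective g).2 hg
  have : Epi (tilde.map g) := inferInstanceAs (Epi ((tilde.functor R).map g))
  have comp_zero : tilde.map f ≫ tilde.map g = 0 := (S₀.map (tilde.functor R)).zero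
  refine ⟨tilde.map g ≫ e.hom, by rw [reassoc_of% comp_zero, zero_comp],
    (S₁.map (tilde.functor R)).zero, inferInstance, ?_, exact₁⟩
  exact ShortComplex.exact_of_iso (ShortComplex.isoMk (S₁ := S₀.map (tilde.functor R))
    (Iso.refl _) (Iso.refl _) e (by simp; rfl) (by simp; rfl)) exact₀

end Tilde

section Coherent

lemma isFiniteType_of_iso {C : Type*} [Category C] {J : GrothendieckTopology C}
    {S : Sheaf J RingCat} [∀ X, HasWeakSheafify (J.over X) AddCommGrpCat]
    [∀ X, (J.over X).WEqualsLocallyBijective AddCommGrpCat] {M N : SheafOfModules S}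
    (e : M ≅ N) (hM : M.IsFiniteType) : N.IsFiniteType := by
  obtain ⟨q, hq⟩ := hM
  have (i : q.I) : IsIso ((SheafOfModules.overFunctor S (q.X i)).map e.hom) :=
    Functor.map_isIso _ e.hom
  let q' : N.LocalGeneratorsData :=
    { I := q.I
      X := q.X
      coversTop := q.coversTop
      generators i :=
        (q.generators i).ofEpi (N := N.over (q.X i))
          ((SheafOfModules.overFunctor S (q.X i)).map e.hom) }
  exact ⟨q', ⟨fun i ↦ ⟨(hq.isFiniteType i).finite⟩⟩⟩

lemma isCoherent_of_iso {X : Scheme.{0}} {M N : X.Modules} (e : M ≅ N) (hM : isCoherent X M) :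
    isCoherent X N :=
  ⟨isQuasicoherent_of_iso (hM := hM.1) e, isFiniteType_of_iso e hM.2⟩

end Coherent

section DirectImage

lemma ιU_π : ιU ≫ π = Spec.map (CommRingCat.ofHom (contractU : A →+* P)) :=
  pushout.inl_desc _ _ _

lemma ιV_π : ιV ≫ π = Spec.map (CommRingCat.ofHom (contractV : A →+* P)) :=
  pushout.inr_desc _ _ _

lemma isQuasicoherent_structureSheaf (R : CommRingCat.{0}) : (𝒪 (Spec R)).IsQuasicoherent :=
  (isQuasicoherent_iff_isIso_fromTildeΓ _).2 inferInstance

instance isQuasicoherent_F : F.IsQuasicoherent := by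
  have (R : CommRingCat.{0}) : (𝒪 (Spec R)).IsQuasicoherent := isQuasicoherent_structureSheaf R
  have := isQuasicoherent_pushforward_pushforward ιU π _ ιU_π (𝒪 chart)
  have := isQuasicoherent_pushforward_pushforward ιV π _ ιV_π (𝒪 chart)
  have := isQuasicoherent_pushforward_pushforward (overlapToU ≫ ιU) π
    (CommRingCat.ofHom (contractU : A →+* P) ≫ CommRingCat.ofHom (algebraMap P Pz))
    (by rw [Category.assoc, ιU_π, Spec.map_comp, overlapToU]) (𝒪 overlap)
  have := isQuasicoherent_pullback
    ((Scheme.Modules.pushforward π).map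
      (resU ≫ (Scheme.Modules.pushforward (overlapToU ≫ ιU)).map (mulO ((zUnit : Pz) ^ 3))))
    ((Scheme.Modules.pushforward π).map resV)
  exact isQuasicoherent_of_iso (PreservesPullback.iso (Scheme.Modules.pushforward π) _ _).symm

end DirectImage

section Cone

open MvPolynomial

lemma y_sq : y ^ 2 = x * w :=
  sub_eq_zero.1 (Ideal.Quotient.eq_zero_iff_mem.2 (Ideal.subset_span rfl))

lemma algHom_ext_cone {S : Type*} [Semiring S] [Algebra ℂ S] {f g : A →ₐ[ℂ] S}
    (hx : f x = g x) (hy : f y = g y) (hw : f w = g w) : f = g :=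
  Ideal.Quotient.algHom_ext _ <| MvPolynomial.algHom_ext fun i ↦ by
    fin_cases i
    exacts [hx, hy, hw]

section Lift

variable {S : Type*} [CommRing S] [Algebra ℂ S] (a b c : S) (h : b ^ 2 = a * c)

/-- The `S`-valued point `(a, b, c)` of the cone `y² = x w`. -/
def conePoint : A →ₐ[ℂ] S :=
  Ideal.Quotient.liftₐ relIdeal (aeval ![a, b, c]) <| by
    have : relIdeal ≤ RingHom.ker (aeval (R := ℂ) ![a, b, c]) := by
      rw [Ideal.span_singleton_le_iff_mem, RingHom.mem_ker]
      simp [h]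
    exact fun _ hr ↦ this hr

@[simp]
lemma conePoint_x : conePoint a b c h x = a :=
  aeval_X (R := ℂ) ![a, b, c] 0

@[simp]
lemma conePoint_y : conePoint a b c h y = b :=
  aeval_X (R := ℂ) ![a, b, c] 1

@[simp]
lemma conePoint_w : conePoint a b c h w = c :=
  aeval_X (R := ℂ) ![a, b, c] 2

end Lift

/-- The embedding of `A` as the ring of even polynomials in two variables `s`, `t`:
`x ↦ s²`, `y ↦ s t`, `w ↦ t²`. -/
def even : A →ₐ[ℂ] P :=
  conePoint (X 0 ^ 2) (X 0 * X 1) (X 1 ^ 2) (by ring)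

lemma even_x : even x = X 0 ^ 2 := conePoint_x _ _ _ _

lemma even_y : even y = X 0 * X 1 := conePoint_y _ _ _ _

lemma even_w : even w = X 1 ^ 2 := conePoint_w _ _ _ _

lemma monomial_fin_two (e : Fin 2 →₀ ℕ) (c : ℂ) :
    (monomial e c : P) = c • (X 0 ^ e 0 * X 1 ^ e 1) := by
  rw [monomial_eq, Finsupp.prod_fintype _ _ (by simp), Fin.prod_univ_two, smul_eq_C_mul]

@[elab_as_elim]
lemma cone_induction {motive : A → Prop} (a : A)
    (smul : ∀ (c : ℂ) i j k, motive (c • (x ^ i * y ^ j * w ^ k)))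
    (add : ∀ p q, motive p → motive q → motive (p + q)) : motive a := by
  obtain ⟨p, rfl⟩ := Ideal.Quotient.mk_surjective a
  induction p using MvPolynomial.induction_on' with
  | monomial e c =>
    convert smul c (e 0) (e 1) (e 2)
    rw [monomial_eq, Finsupp.prod_fintype _ _ (by simp), Fin.prod_univ_three, ← smul_eq_C_mul]
    rfl
  | add p q hp hq => exact map_add (Ideal.Quotient.mk relIdeal) p q ▸ add _ _ hp hq

/-- A linear retraction of the contraction on `U`: modulo `y² = x w`, the monomial `zⁱ uʲ` in the
image of the contraction comes from `x ^ (j - ⌈i / 2⌉) * y ^ (i % 2) * w ^ ⌊i / 2⌋`. -/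
def retractU : P →ₗ[ℂ] A :=
  (basisMonomials (Fin 2) ℂ).constr ℂ fun e ↦
    x ^ (e 1 - (e 0 + 1) / 2) * y ^ (e 0 % 2) * w ^ (e 0 / 2)

lemma retractU_monomial (i j : ℕ) : retractU (X 0 ^ i * X 1 ^ j) =
    x ^ (j - (i + 1) / 2) * y ^ (i % 2) * w ^ (i / 2) := by
  have : (X 0 ^ i * X 1 ^ j : P) =
      basisMonomials (Fin 2) ℂ (Finsupp.single 0 i + Finsupp.single 1 j) := by
    simp [coe_basisMonomials, monomial_fin_two]
  rw [this, retractU, Module.Basis.constr_basis]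
  simp

lemma retractU_contractU (a : A) : retractU (contractU a) = a := by
  induction a using cone_induction with
  | add p q hp hq => rw [map_add, map_add, hp, hq]
  | smul c i j k =>
    have contract_monomial :
        contractU (x ^ i * y ^ j * w ^ k) = X 0 ^ (j + 2 * k) * X 1 ^ (i + j + k) := by
      simp only [map_mul, map_pow, contractU_x, contractU_y, contractU_w]
      ring
    rw [map_smul, map_smul, contract_monomial, retractU_monomial,
      show i + j + k - (j + 2 * k + 1) / 2 = i + j / 2 by omega,
      show (j + 2 * k) % 2 = j % 2 by omega, show (j + 2 * k) / 2 = j / 2 + k by omega]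
    conv_rhs => rw [← Nat.div_add_mod j 2, pow_add, pow_mul, y_sq]
    ring_nf

lemma contractU_injective : Function.Injective contractU :=
  Function.LeftInverse.injective retractU_contractU

-- Substituting `s = u` and `t = z² u` turns `even` into the contraction, with squared coordinates.
lemma even_injective : Function.Injective even := by
  have expand_contractU : (expand 2).comp contractU =
      (aeval (R := ℂ) ![X 1, X 0 ^ 2 * X 1] : P →ₐ[ℂ] P).comp even := by
    apply algHom_ext_cone <;>
      simp [contractU_x, contractU_y, contractU_w, even_x, even_y, even_w] <;> ring
  intro a b h
  refine contractU_injective (expand_injective (R := ℂ) two_pos ?_)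
  have ha := congr($expand_contractU a)
  have hb := congr($expand_contractU b)
  simp only [AlgHom.comp_apply, h] at ha hb
  exact ha.trans hb.symm

instance : IsDomain A := even_injective.isDomain even.toRingHom

/-- The involution `s ↦ -s`, `t ↦ -t`. -/
def negVars : P →ₐ[ℂ] P := aeval ![-X 0, -X 1]

lemma negVars_X0 : negVars (X 0) = -X 0 := by simp [negVars]

lemma negVars_X1 : negVars (X 1) = -X 1 := by simp [negVars]

lemma negVars_negVars (f : P) : negVars (negVars f) = f := by
  have : negVars.comp negVars = AlgHom.id ℂ P := by
    refine MvPolynomial.algHom_ext fun i ↦ ?_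
    fin_cases i <;> simp [negVars]
  exact congr($this f)

lemma negVars_even (a : A) : negVars (even a) = even a := by
  have : negVars.comp even = even := by
    apply algHom_ext_cone <;> simp [even_x, even_y, even_w, negVars_X0, negVars_X1]
  exact congr($this a)

lemma exists_eq_even_add (f : P) : ∃ a c d, f = even a + (X 0 * even c + X 1 * even d) := by
  induction f using MvPolynomial.induction_on with
  | C r => exact ⟨algebraMap ℂ A r, 0, 0, by simp [MvPolynomial.algebraMap_eq]⟩
  | add p q hp hq =>
    obtain ⟨a, c, d, rfl⟩ := hp
    obtain ⟨a', c', d', rfl⟩ := hq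
    exact ⟨a + a', c + c', d + d', by simp only [map_add]; ring⟩
  | mul_X p i hp =>
    obtain ⟨a, c, d, rfl⟩ := hp
    fin_cases i
    · exact ⟨x * c + y * d, a, 0, by simp [even_x, even_y]; ring⟩
    · exact ⟨y * c + w * d, 0, a, by simp [even_y, even_w]; ring⟩

lemma negVars_odd (c d : A) :
    negVars (X 0 * even c + X 1 * even d) = -(X 0 * even c + X 1 * even d) := by
  simp only [map_add, map_mul, negVars_X0, negVars_X1, negVars_even]
  ring

lemma exists_eq_even_of_negVars_eq {f : P} (h : negVars f = f) : ∃ a, f = even a := by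
  obtain ⟨a, c, d, rfl⟩ := exists_eq_even_add f
  rw [map_add, negVars_even, negVars_odd, add_right_inj, neg_eq_self] at h
  exact ⟨a, by rw [h, add_zero]⟩

lemma exists_eq_odd_of_negVars_eq_neg {f : P} (h : negVars f = -f) :
    ∃ c d, f = X 0 * even c + X 1 * even d := by
  obtain ⟨a, c, d, rfl⟩ := exists_eq_even_add f
  rw [map_add, negVars_even, negVars_odd, neg_add (even a), add_left_inj, self_eq_neg] at h
  exact ⟨c, d, by rw [h, zero_add]⟩

/-- The ideal `(x, y)` of `A`, which defines the line `x = y = 0` on the cone. -/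
def ruling : Ideal A := Ideal.span {x, y}

lemma mem_ruling {a : A} : a ∈ ruling ↔ ∃ c d, a = x * c + y * d := by
  rw [ruling, Ideal.mem_span_pair]
  simp only [mul_comm x, mul_comm y, eq_comm]

lemma x_mem_ruling : x ∈ ruling := Ideal.subset_span (.inl rfl)

lemma y_mem_ruling : y ∈ ruling := Ideal.subset_span (.inr rfl)

lemma mem_ruling_iff_dvd {a : A} : a ∈ ruling ↔ X 0 ∣ even a := by
  rw [mem_ruling]
  constructor
  · rintro ⟨c, d, rfl⟩
    exact ⟨X 0 * even c + X 1 * even d, by simp only [map_add, map_mul, even_x, even_y]; ring⟩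
  · rintro ⟨f, hf⟩
    have odd_f : negVars f = -f := by
      have := negVars_even a
      rw [hf, map_mul, negVars_X0, neg_mul, ← mul_neg] at this
      exact neg_eq_iff_eq_neg.1 (mul_left_cancel₀ (X_ne_zero 0) this)
    obtain ⟨c, d, rfl⟩ := exists_eq_odd_of_negVars_eq_neg odd_f
    exact ⟨c, d, even_injective (by rw [hf]; simp only [map_add, map_mul, even_x, even_y]; ring)⟩

end Cone

section GlobalSections

/-- Restriction of sections of `𝒪(-3)` to the chart `U`. -/
def toU : L ⟶ (Scheme.Modules.pushforward ιU).obj (𝒪 chart) := pullback.fst _ _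

/-- Restriction of sections of `𝒪(-3)` to the chart `V`. -/
def toV : L ⟶ (Scheme.Modules.pushforward ιV).obj (𝒪 chart) := pullback.snd _ _

/-- The functor of global sections of sheaves of modules, as a functor to types. -/
def globalSections (X : Scheme.{0}) : X.Modules ⥤ Type :=
  Scheme.Modules.toPresheaf X ⋙ (evaluation _ _).obj (.op ⊤) ⋙ forget Ab

instance (X : Scheme.{0}) : PreservesLimits (globalSections X) := by
  have : PreservesLimits ((evaluation X.Opensᵒᵖ Ab).obj (.op ⊤) ⋙ forget Ab) :=
    comp_preservesLimits _ _
  exact comp_preservesLimits _ _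

lemma isPullback_globalSections :
    IsPullback ((globalSections Z₂).map toU) ((globalSections Z₂).map toV)
      ((globalSections Z₂).map (resU ≫ (Scheme.Modules.pushforward (overlapToU ≫ ιU)).map
        (mulO ((zUnit : Pz) ^ 3)))) ((globalSections Z₂).map resV) :=
  (IsPullback.of_hasPullback _ _).map _

lemma mulO_app_top {R : CommRingCat.{0}} (r m : R) :
    (mulO r).app ⊤ ((Scheme.ΓSpecIso R).inv m) = (Scheme.ΓSpecIso R).inv (r * m) :=
  congr($(tilde.toOpen_map_app (ModuleCat.ofHom (LinearMap.mulLeft R r)) ⊤).hom m)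

lemma resV_app_top (a : Γ(chart, ⊤)) : resV.app ⊤ a = overlapToV.appTop a := by
  change overlap.presheaf.map (𝟙 _) _ = _
  rw [CategoryTheory.Functor.map_id]
  rfl

lemma overlapToU_appTop (p : P) : overlapToU.appTop ((Scheme.ΓSpecIso (.of P)).inv p) =
    (Scheme.ΓSpecIso (.of Pz)).inv (algebraMap P Pz p) :=
  congr($(Scheme.ΓSpecIso_inv_naturality (CommRingCat.ofHom (algebraMap P Pz))) p).symm

lemma overlapToV_appTop (p : P) : overlapToV.appTop ((Scheme.ΓSpecIso (.of P)).inv p) =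
    (Scheme.ΓSpecIso (.of Pz)).inv (transPoly p) := by
  have naturality := Scheme.ΓSpecIso_inv_naturality (CommRingCat.ofHom (algebraMap P Pz) ≫
    CommRingCat.ofHom (transEquiv : Pz →+* Pz))
  rw [Spec.map_comp] at naturality
  rw [← transAux_algebraMap]
  exact congr($naturality p).symm

lemma gluingU_app_top (a : P) : (resU ≫ (Scheme.Modules.pushforward (overlapToU ≫ ιU)).map
    (mulO ((zUnit : Pz) ^ 3))).app ⊤ ((Scheme.ΓSpecIso (.of P)).inv a) =
      (Scheme.ΓSpecIso (.of Pz)).inv ((zUnit : Pz) ^ 3 * algebraMap P Pz a) := by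
  rw [← mulO_app_top (R := .of Pz), ← overlapToU_appTop]
  rfl

lemma gluingV_app_top (b : P) : resV.app ⊤ ((Scheme.ΓSpecIso (.of P)).inv b) =
    (Scheme.ΓSpecIso (.of Pz)).inv (transPoly b) := by
  rw [← overlapToV_appTop]
  exact resV_app_top _

/-- The module of global sections of `F`. -/
abbrev ΓF : ModuleCat A := (moduleSpecΓFunctor (R := CommRingCat.of A)).obj F

/-- The function on the chart `U` given by a global section of `F`. -/
def sectionU (s : ΓF) : P := (Scheme.ΓSpecIso (.of P)).hom (toU.app ⊤ s)

/-- The function on the chart `V` given by a global section of `F`. -/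
def sectionV (s : ΓF) : P := (Scheme.ΓSpecIso (.of P)).hom (toV.app ⊤ s)

lemma inv_sectionU (s : ΓF) : (Scheme.ΓSpecIso (.of P)).inv (sectionU s) = toU.app ⊤ s :=
  Iso.hom_inv_id_apply (Scheme.ΓSpecIso (.of P)) (toU.app ⊤ s)

lemma inv_sectionV (s : ΓF) : (Scheme.ΓSpecIso (.of P)).inv (sectionV s) = toV.app ⊤ s :=
  Iso.hom_inv_id_apply (Scheme.ΓSpecIso (.of P)) (toV.app ⊤ s)

lemma sectionU_add (s t : ΓF) : sectionU (s + t) = sectionU s + sectionU t :=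
  (congrArg _ (map_add (toU.app ⊤).hom s t)).trans
    (map_add (Scheme.ΓSpecIso (.of P)).hom.hom _ _)

lemma appTop_contractU (a : A) : (Scheme.ΓSpecIso (.of P)).hom
    (ιU.appTop (π.appTop ((Scheme.ΓSpecIso (.of A)).inv a))) = contractU a := by
  have h : (Scheme.ΓSpecIso (.of A)).inv ≫ (ιU ≫ π).appTop ≫ (Scheme.ΓSpecIso (.of P)).hom =
      CommRingCat.ofHom (contractU : A →+* P) := by
    rw [ιU_π, Scheme.ΓSpecIso_naturality, Iso.inv_hom_id_assoc]
  exact congr($h a)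

lemma sectionU_smul (a : A) (s : ΓF) : sectionU (a • s) = contractU a * sectionU s := by
  have toU_smul : toU.app ⊤ (a • s) =
      (ιU.appTop (π.appTop (X₂.presheaf.map (𝟙 _) ((Scheme.ΓSpecIso (.of A)).inv a))) :
        Γ(chart, ⊤)) * (show Γ(chart, ⊤) from toU.app ⊤ s) :=
    Scheme.Modules.Hom.app_smul toU (U := ⊤)
      (π.appTop (X₂.presheaf.map (𝟙 _) ((Scheme.ΓSpecIso (.of A)).inv a))) s
  rw [CategoryTheory.Functor.map_id] at toU_smul
  rw [sectionU, toU_smul, ← appTop_contractU]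
  exact map_mul (Scheme.ΓSpecIso (.of P)).hom.hom _ _

lemma ΓSpecIso_inv_injective (R : CommRingCat.{0}) : Function.Injective (Scheme.ΓSpecIso R).inv :=
  (Scheme.ΓSpecIso R).symm.commRingCatIsoToRingEquiv.injective

lemma gluing_sections (s : ΓF) :
    (zUnit : Pz) ^ 3 * algebraMap P Pz (sectionU s) = transPoly (sectionV s) := by
  apply ΓSpecIso_inv_injective (.of Pz)
  rw [← gluingU_app_top, ← gluingV_app_top, inv_sectionU, inv_sectionV]
  exact congr($(isPullback_globalSections.w) s)

lemma exists_sectionU_eq {a b : P} (h : (zUnit : Pz) ^ 3 * algebraMap P Pz a = transPoly b) :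
    ∃ s : ΓF, sectionU s = a := by
  obtain ⟨s, hs, -⟩ := Types.exists_of_isPullback isPullback_globalSections
    ((Scheme.ΓSpecIso (.of P)).inv a) ((Scheme.ΓSpecIso (.of P)).inv b)
    ((gluingU_app_top a).trans ((congrArg _ h).trans (gluingV_app_top b).symm))
  exact ⟨s, ΓSpecIso_inv_injective (.of P) ((inv_sectionU s).trans hs)⟩

lemma algebraMap_Pz_injective : Function.Injective (algebraMap P Pz) :=
  IsLocalization.injective Pz
    (powers_le_nonZeroDivisors_of_noZeroDivisors (MvPolynomial.X_ne_zero 0))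

lemma transPoly_injective : Function.Injective transPoly := by
  intro a b h
  rw [← transAux_algebraMap, ← transAux_algebraMap] at h
  exact algebraMap_Pz_injective (transEquiv.injective h)

lemma sectionU_injective : Function.Injective sectionU := by
  intro s t hU
  have hV : sectionV s = sectionV t := transPoly_injective <| by
    rw [← gluing_sections, ← gluing_sections, hU]
  refine Types.ext_of_isPullback isPullback_globalSections ?_ ?_
  · exact (inv_sectionU s).symm.trans ((congrArg _ hU).trans (inv_sectionU t))
  · exact (inv_sectionV s).symm.trans ((congrArg _ hV).trans (inv_sectionV t))

end GlobalSections

section GluedFunctions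

open MvPolynomial

lemma monomial_mul_mem_restrictSupport {σ R : Type*} [CommSemiring R] {s : Set (σ →₀ ℕ)}
    (d : σ →₀ ℕ) (f : MvPolynomial σ R) : monomial d 1 * f ∈ restrictSupport R s ↔
      f ∈ restrictSupport R ((d + ·) ⁻¹' s) := by
  simp only [mem_restrictSupport_iff]
  constructor
  · intro h e he
    exact h (by simpa [coeff_monomial_mul] using he)
  · intro h e he
    rw [Finset.mem_coe, mem_support_iff, coeff_monomial_mul', one_mul, ne_eq, ite_eq_right_iff,
      Classical.not_imp] at he
    simpa [add_tsub_cancel_of_le he.1] using h (mem_support_iff.2 he.2)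

/-- The polynomials `f` whose monomials `zⁱ uʲ` satisfy `i ≤ k + 2 j`: those for which
`z⁻ᵏ f` is a function on `V`, where `zⁱ uʲ` is `ξ ^ (2 j - i) * v ^ j`. -/
def growth (k : ℤ) : Submodule ℂ P := restrictSupport ℂ {e | (e 0 : ℤ) ≤ k + 2 * e 1}

lemma growth_mono {k l : ℤ} (h : k ≤ l) : growth k ≤ growth l :=
  restrictSupport_mono ℂ fun e (he : (e 0 : ℤ) ≤ k + 2 * e 1) ↦ he.trans (by omega)

lemma X0_pow_mul_mem_growth {k : ℤ} {n : ℕ} {f : P} :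
    X 0 ^ n * f ∈ growth k ↔ f ∈ growth (k - n) := by
  rw [X_pow_eq_monomial, growth, monomial_mul_mem_restrictSupport, growth]
  congr! 2
  ext e
  simp only [Set.preimage_ofPred_eq, Set.mem_ofPred_eq, Finsupp.add_apply, Finsupp.single_eq_same,
    Finsupp.single_eq_of_ne one_ne_zero, zero_add, Nat.cast_add]
  omega

lemma X1_mul_mem_growth {k : ℤ} {f : P} : X 1 * f ∈ growth k ↔ f ∈ growth (k + 2) := by
  rw [X, growth, monomial_mul_mem_restrictSupport, growth]
  congr! 2
  ext e
  simp only [Set.preimage_ofPred_eq, Set.mem_ofPred_eq, Finsupp.add_apply, Finsupp.single_eq_same,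
    Finsupp.single_eq_of_ne zero_ne_one, zero_add, Nat.cast_add, Nat.cast_one]
  omega

lemma exists_pow_mul_transPoly_eq (b : P) : ∃ (n : ℕ), ∃ q ∈ growth n,
    (zUnit : Pz) ^ n * transPoly b = algebraMap P Pz q := by
  induction b using MvPolynomial.induction_on with
  | C r =>
    refine ⟨0, C r, (monomial_mem_restrictSupport ℂ).2 (.inl (by simp)), ?_⟩
    rw [pow_zero, one_mul, ← MvPolynomial.algebraMap_eq, AlgHom.commutes]
    rfl
  | add p q hp hq =>
    obtain ⟨n, f, f_mem, hf⟩ := hp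
    obtain ⟨m, g, g_mem, hg⟩ := hq
    refine ⟨n + m, X 0 ^ m * f + X 0 ^ n * g, add_mem ?_ ?_, ?_⟩
    · exact X0_pow_mul_mem_growth.2 (growth_mono (by simp) f_mem)
    · exact X0_pow_mul_mem_growth.2 (growth_mono (by simp) g_mem)
    · simp only [map_add, map_mul, map_pow, ← hf, ← hg, algebraMap_X0]
      ring
  | mul_X p i hp =>
    obtain ⟨n, f, f_mem, hf⟩ := hp
    fin_cases i
    · refine ⟨n + 1, f, growth_mono (by simp) f_mem, ?_⟩
      simp only [Fin.zero_eta, map_mul, transPoly_X0, ← hf]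
      linear_combination (zUnit : Pz) ^ n * transPoly p * zUnit.mul_inv
    · refine ⟨n, X 0 ^ 2 * (X 1 * f), ?_, ?_⟩
      · exact X0_pow_mul_mem_growth.2 (X1_mul_mem_growth.2 (growth_mono (by simp) f_mem))
      · simp only [Fin.mk_one, map_mul, map_pow, transPoly_X1, algebraMap_X0, ← hf]
        ring

lemma mem_growth_of_gluing {a b : P}
    (h : (zUnit : Pz) ^ 3 * algebraMap P Pz a = transPoly b) : a ∈ growth (-3) := by
  obtain ⟨n, q, q_mem, hq⟩ := exists_pow_mul_transPoly_eq b
  have q_eq : q = X 0 ^ (n + 3) * a := algebraMap_Pz_injective <| by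
    rw [← hq, ← h, map_mul, map_pow, algebraMap_X0]
    ring
  rw [q_eq, X0_pow_mul_mem_growth] at q_mem
  exact growth_mono (by simp) q_mem

lemma algebraMap_contractU (a : A) : algebraMap P Pz (contractU a) = transPoly (contractV a) := by
  have h := contract_condition
  rw [overlapToU, overlapToV, ← Spec.map_comp, ← Spec.map_comp, ← Spec.map_comp] at h
  exact congr($(Spec.map_injective h) a).trans (transAux_algebraMap _)

lemma gluing_generators (c d : A) :
    (zUnit : Pz) ^ 3 * algebraMap P Pz (X 1 * contractU (x * c + y * d)) =
      transPoly (X 0 * X 1 ^ 2 * contractV c + X 1 ^ 2 * contractV d) := by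
  simp only [map_add, map_mul, map_pow, contractU_x, contractU_y, algebraMap_contractU,
    transPoly_X0, transPoly_X1, algebraMap_X0]
  linear_combination
    (-(zUnit : Pz) ^ 3 * algebraMap P Pz (X 1) ^ 2 * transPoly (contractV c)) * zUnit.mul_inv

/-- The polynomial ring in two variables as an `A`-module by means of the contraction on `U`. -/
abbrev moduleU : Module A P := Module.compHom P (contractU : A →+* P)

attribute [local instance] moduleU

/-- Multiplication by `u` on the ideal `(x, y)`, with values in the functions on `U`. -/
def rulingToP : ruling →ₗ[A] P where
  toFun i := X 1 * contractU i
  map_add' i j := by simp [mul_add]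
  map_smul' a i := by
    change X 1 * contractU (a * i) = contractU a * (X 1 * contractU i)
    rw [map_mul, mul_left_comm]

/-- Restriction of global sections of `F` to the chart `U`, as a linear map. -/
def sectionsToP : ΓF →ₗ[A] P where
  toFun := sectionU
  map_add' := sectionU_add
  map_smul' := sectionU_smul

lemma rulingToP_injective : Function.Injective rulingToP := fun _ _ h ↦
  Subtype.ext (contractU_injective (mul_left_cancel₀ (X_ne_zero 1) h))

lemma monomial_mem_range_rulingToP {e : Fin 2 →₀ ℕ} (he : (e 0 : ℤ) ≤ -3 + 2 * e 1) (r : ℂ) :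
    monomial e r ∈ LinearMap.range rulingToP := by
  rw [monomial_fin_two]
  obtain ⟨k, h₀⟩ := Nat.even_or_odd' (e 0)
  obtain ⟨l, h₁⟩ : ∃ l, e 1 = k + 2 + l := ⟨e 1 - k - 2, by omega⟩
  have contract_monomial :
      contractU (r • (x ^ l * w ^ k)) = r • (X 0 ^ (2 * k) * X 1 ^ (l + k)) := by
    rw [map_smul, map_mul, map_pow, map_pow, contractU_x, contractU_w]
    ring_nf
  rcases h₀ with h₀ | h₀
  · refine ⟨⟨x * (r • (x ^ l * w ^ k)), ruling.mul_mem_right _ x_mem_ruling⟩, ?_⟩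
    change X 1 * contractU (x * (r • (x ^ l * w ^ k))) = _
    rw [map_mul, contractU_x, contract_monomial, h₀, h₁, mul_smul_comm, mul_smul_comm]
    ring_nf
  · refine ⟨⟨y * (r • (x ^ l * w ^ k)), ruling.mul_mem_right _ y_mem_ruling⟩, ?_⟩
    change X 1 * contractU (y * (r • (x ^ l * w ^ k))) = _
    rw [map_mul, contractU_y, contract_monomial, h₀, h₁, mul_smul_comm, mul_smul_comm]
    ring_nf

lemma range_rulingToP : LinearMap.range rulingToP = LinearMap.range sectionsToP := by
  apply le_antisymm
  · rintro _ ⟨⟨i, hi⟩, rfl⟩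
    obtain ⟨c, d, rfl⟩ := mem_ruling.1 hi
    exact exists_sectionU_eq (gluing_generators c d)
  · rintro _ ⟨s, rfl⟩
    have support_subset := (mem_restrictSupport_iff ℂ).1
      (mem_growth_of_gluing (gluing_sections s))
    change sectionU s ∈ _
    rw [(sectionU s).as_sum]
    exact sum_mem fun e he ↦ monomial_mem_range_rulingToP (support_subset he) _

/-- The module of global sections of `F` is isomorphic to the ideal `(x, y)`. -/
def rulingEquiv : ruling ≃ₗ[A] ΓF :=
  LinearEquiv.ofInjective rulingToP rulingToP_injective ≪≫ₗ
    LinearEquiv.ofEq _ _ range_rulingToP ≪≫ₗ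
    (LinearEquiv.ofInjective sectionsToP sectionU_injective).symm

end GluedFunctions

section MatrixFactorization

open MvPolynomial

lemma exists_injective_exact_of_exact {R M N : Type*} [CommRing R] [AddCommGroup M] [Module R M]
    [AddCommGroup N] [Module R N] {f : M →ₗ[R] M} {g : M →ₗ[R] N} (hff : Function.Exact f f)
    (hfg : Function.Exact f g) (hg : Function.Surjective g) :
    ∃ i : N →ₗ[R] M, Function.Injective i ∧ Function.Exact i g := by
  have hker : LinearMap.ker g = LinearMap.ker f :=
    (LinearMap.exact_iff.1 hfg).trans (LinearMap.exact_iff.1 hff).symm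
  let e := g.quotKerEquivOfSurjective hg
  let j := (LinearMap.ker g).liftQ f hker.le
  have hj : Function.Injective j :=
    LinearMap.ker_eq_bot.1 (Submodule.ker_liftQ_eq_bot _ _ _ hker.ge)
  refine ⟨j ∘ₗ e.symm, hj.comp e.symm.injective, LinearMap.exact_iff.2 ?_⟩
  rw [LinearEquiv.range_comp, Submodule.range_liftQ, LinearMap.exact_iff.1 hfg]

lemma rank_ideal_eq_one {R : Type*} [CommRing R] [IsDomain R] {I : Ideal R} (hI : I ≠ ⊥) :
    Module.rank R I = 1 := by
  obtain ⟨a, ha, ha0⟩ := I.ne_bot_iff.1 hI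
  have hle : Module.rank R I ≤ Module.rank R R :=
    LinearMap.rank_le_of_injective I.subtype Subtype.val_injective
  have hge : Module.rank R R ≤ Module.rank R I :=
    LinearMap.rank_le_of_injective (LinearMap.toSpanSingleton R I ⟨a, ha⟩) fun _ _ h ↦
      mul_right_cancel₀ ha0 (congrArg Subtype.val h)
  exact (hle.antisymm hge).trans (Module.rank_self R)

lemma x_ne_zero : x ≠ 0 := fun h ↦
  pow_ne_zero 2 (X_ne_zero (R := ℂ) (0 : Fin 2)) (by rw [← even_x, h, map_zero])

lemma rank_ruling : Module.rank A ruling = 1 :=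
  rank_ideal_eq_one fun h ↦ x_ne_zero ((Submodule.eq_bot_iff _).1 h x x_mem_ruling)

/-- The surjection `A² → (x, y)` given by the two generators. -/
def rulingCover : (Fin 2 → A) →ₗ[A] ruling :=
  Fintype.linearCombination A ![⟨x, x_mem_ruling⟩, ⟨y, y_mem_ruling⟩]

/-- The endomorphism of `A²` given by the matrix `φ`, whose square is zero because
`y² = xw`. -/
abbrev factorization : (Fin 2 → A) →ₗ[A] (Fin 2 → A) := Matrix.mulVecLin !![y, w; -x, -y]

lemma coe_rulingCover (v : Fin 2 → A) : (rulingCover v : A) = x * v 0 + y * v 1 := by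
  simp [rulingCover, Fintype.linearCombination_apply, mul_comm]

lemma factorization_apply (v : Fin 2 → A) :
    factorization v = ![y * v 0 + w * v 1, -(x * v 0 + y * v 1)] := by
  refine funext (Fin.forall_fin_two.2 ⟨?_, ?_⟩)
  · exact Matrix.vec2_dotProduct _ _
  · exact (Matrix.vec2_dotProduct _ _).trans (by simp; ring)

lemma rulingCover_surjective : Function.Surjective rulingCover := by
  rintro ⟨a, ha⟩
  obtain ⟨c, d, rfl⟩ := mem_ruling.1 ha
  exact ⟨![c, d], Subtype.ext (coe_rulingCover _)⟩

lemma rulingCover_eq_zero_iff {v : Fin 2 → A} : rulingCover v = 0 ↔ x * v 0 + y * v 1 = 0 := by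
  rw [← coe_rulingCover, ZeroMemClass.coe_eq_zero]

lemma mem_ruling_of_mul_add_mul_eq_zero {a b : A} (h : x * a + y * b = 0) : b ∈ ruling := by
  have hX0 : Prime (X 0 : P) := X_prime
  have hX01 : ¬ (X 0 : P) ∣ X 1 := by simp [X_dvd_X]
  have heven : X 0 * (X 0 * even a + X 1 * even b) = 0 := by
    rw [← map_zero even, ← h, map_add, map_mul, map_mul, even_x, even_y]
    ring
  have hsum := (mul_eq_zero.1 heven).resolve_left hX0.ne_zero
  have hdvd : (X 0 : P) ∣ X 1 * even b := ⟨-even a, by linear_combination hsum⟩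
  exact mem_ruling_iff_dvd.2 ((hX0.dvd_or_dvd hdvd).resolve_left hX01)

lemma exact_factorization_rulingCover : Function.Exact factorization rulingCover := by
  intro v
  rw [rulingCover_eq_zero_iff]
  constructor
  · intro hv
    obtain ⟨c, d, hcd⟩ := mem_ruling.1 (mem_ruling_of_mul_add_mul_eq_zero hv)
    have hv₀ : v 0 = -(y * c + w * d) :=
      mul_left_cancel₀ x_ne_zero (by linear_combination hv - y * hcd - d * y_sq)
    refine ⟨![-c, -d], ?_⟩
    rw [factorization_apply]
    refine funext (Fin.forall_fin_two.2 ⟨?_, ?_⟩)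
    · change y * -c + w * -d = v 0
      linear_combination -hv₀
    · change -(x * -c + y * -d) = v 1
      linear_combination -hcd
  · rintro ⟨u, rfl⟩
    simp only [factorization_apply, Matrix.cons_val_zero, Matrix.cons_val_one]
    linear_combination (-u 1) * y_sq

lemma factorization_eq_zero_iff (v : Fin 2 → A) : factorization v = 0 ↔ rulingCover v = 0 := by
  rw [rulingCover_eq_zero_iff, factorization_apply]
  refine ⟨fun h ↦ neg_eq_zero.1 (congrFun h 1), fun h ↦ ?_⟩
  have hrow : y * v 0 + w * v 1 = 0 :=
    mul_left_cancel₀ x_ne_zero (by linear_combination y * h - v 1 * y_sq)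
  rw [hrow, h, neg_zero]
  simp

lemma exact_factorization : Function.Exact factorization factorization := fun v ↦
  (factorization_eq_zero_iff v).trans (exact_factorization_rulingCover v)

/-- The origin of the cone, as a point with values in `ℂ`. -/
def origin : A →ₐ[ℂ] ℂ := conePoint 0 0 0 (by simp)

lemma origin_eq_zero_of_rulingCover_eq_zero {v : Fin 2 → A} (hv : rulingCover v = 0) (i : Fin 2) :
    origin (v i) = 0 := by
  obtain ⟨u, rfl⟩ := (exact_factorization_rulingCover v).1 hv
  rw [factorization_apply]
  fin_cases i <;> simp [origin]

lemma not_projective_ruling : ¬ Module.Projective A ruling := by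
  intro _
  obtain ⟨r, hr⟩ := Module.projective_lifting_property rulingCover LinearMap.id
    rulingCover_surjective
  have hsection (i : ruling) : rulingCover (r i) = i := congr($hr i)
  let v := r ⟨x, x_mem_ruling⟩
  let v' := r ⟨y, y_mem_ruling⟩
  have hcomm : y • v = x • v' := by
    rw [← map_smul, ← map_smul]
    exact congrArg r (Subtype.ext (mul_comm y x))
  have hv : origin (v 0) = 0 := by
    refine origin_eq_zero_of_rulingCover_eq_zero (v := ![-v' 0, v 0]) ?_ 1
    rw [rulingCover_eq_zero_iff]
    have hcomm₀ : y * v 0 = x * v' 0 := congrFun hcomm 0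
    simp only [Matrix.cons_val_zero, Matrix.cons_val_one]
    linear_combination hcomm₀
  have hv_sub : origin (v 0 - 1) = 0 := by
    refine origin_eq_zero_of_rulingCover_eq_zero (v := ![v 0 - 1, v 1]) ?_ 0
    rw [rulingCover_eq_zero_iff]
    have hcover : x * v 0 + y * v 1 = x := by
      rw [← coe_rulingCover, hsection]
    simp only [Matrix.cons_val_zero, Matrix.cons_val_one]
    linear_combination hcover
  simp [hv] at hv_sub

end MatrixFactorization

section Primes

open MvPolynomial

lemma exists_prime_span_eq_of_ringKrullDim_le_two {R : Type*} [CommRing R] [IsDomain R]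
    [UniqueFactorizationMonoid R] (hR : ringKrullDim R ≤ 2) {q : Ideal R} [hq : q.IsPrime]
    (hq₀ : q ≠ ⊥) (hqm : ¬ q.IsMaximal) : ∃ g, Prime g ∧ q = Ideal.span {g} := by
  obtain ⟨m, hm, hle⟩ := q.exists_le_maximal hq.ne_top
  have hlt : q < m := hle.lt_of_ne (by rintro rfl; exact hqm hm)
  have hheight_m : m.height ≤ 2 :=
    WithBot.coe_le_coe.1 ((Ideal.height_le_ringKrullDim_of_ne_top hm.ne_top).trans hR)
  have hheight_q : q.height + 1 ≤ 1 + 1 :=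
    ((Ideal.height_add_one_le_of_lt_of_isPrime hlt).trans hheight_m).trans_eq
      one_add_one_eq_two.symm
  have hheight : q.height = 1 :=
    ((ENat.add_le_add_iff_right ENat.one_ne_top).1 hheight_q).antisymm <|
      Order.one_le_iff_ne_zero.2 <| Ideal.height_eq_zero_iff_eq_bot.not.2 hq₀
  obtain ⟨g, hgq, hg⟩ := hq.exists_mem_prime_of_ne_bot hq₀
  exact ⟨g, hg, q.eq_span_singleton_of_height_eq_one hheight hgq hg⟩

lemma nonempty_linearEquiv_of_span_mul_eq {R : Type*} [CommRing R] [IsDomain R] {a b : R}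
    {I J : Ideal R} (ha : a ≠ 0) (hb : b ≠ 0) (h : Ideal.span {a} * I = Ideal.span {b} * J) :
    Nonempty (I ≃ₗ[R] J) := by
  have hmap (c : R) (K : Ideal R) :
      Submodule.map (LinearMap.mulLeft R c) K = Ideal.span {c} * K :=
    Submodule.ext fun _ ↦ Ideal.mem_span_singleton_mul.symm
  let scale {c : R} (hc : c ≠ 0) (K : Ideal R) : K ≃ₗ[R] ↥(Ideal.span {c} * K) :=
    Submodule.equivMapOfInjective (LinearMap.mulLeft R c) (mul_right_injective₀ hc) K ≪≫ₗ
      LinearEquiv.ofEq _ _ (hmap c K)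
  exact ⟨scale ha I ≪≫ₗ LinearEquiv.ofEq _ _ h ≪≫ₗ (scale hb J).symm⟩

lemma even_isIntegral : (even : A →+* P).IsIntegral := by
  have isIntegralElem_of_sq {f : P} {a : A} (h : f ^ 2 = even a) :
      (even : A →+* P).IsIntegralElem f :=
    ⟨Polynomial.X ^ 2 - Polynomial.C a, Polynomial.monic_X_pow_sub_C a two_ne_zero, by simp [h]⟩
  intro f
  induction f using MvPolynomial.induction_on with
  | C c =>
    rw [← algebraMap_eq, ← even.commutes]
    exact RingHom.isIntegralElem_map _
  | add f g hf hg => exact hf.add _ hg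
  | mul_X f i hf =>
    refine hf.mul _ ?_
    fin_cases i
    · exact isIntegralElem_of_sq even_x.symm
    · exact isIntegralElem_of_sq even_w.symm

lemma exists_prime_comap_even_eq {p : Ideal A} [p.IsPrime] (hp₀ : p ≠ ⊥) (hp : ¬ p.IsMaximal) :
    ∃ g : P, Prime g ∧ p = (Ideal.span {g}).comap even := by
  let _ : Algebra A P := even.toAlgebra
  have _ : Algebra.IsIntegral A P := ⟨even_isIntegral⟩
  have hbot : (⊥ : Ideal P).comap even = ⊥ :=
    Ideal.comap_bot_of_injective even even_injective
  obtain ⟨q, -, _, hqp⟩ := Ideal.exists_ideal_over_prime_of_isIntegral (S := P) p ⊥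
    (hbot.trans_le bot_le)
  have hq₀ : q ≠ ⊥ := by
    rintro rfl
    exact hp₀ (hqp.symm.trans hbot)
  have hqm : ¬ q.IsMaximal := fun hq ↦
    hp (hqp ▸ Ideal.isMaximal_comap_of_isIntegral_of_isMaximal q)
  have hdim : ringKrullDim P ≤ 2 := by
    rw [MvPolynomial.ringKrullDim_of_isNoetherianRing, ringKrullDim_eq_zero_of_field]
    simp
  obtain ⟨g, hg, rfl⟩ := exists_prime_span_eq_of_ringKrullDim_le_two hdim hq₀ hqm
  exact ⟨g, hg, hqp.symm⟩

lemma comap_even_span_even (a : A) : (Ideal.span {even a}).comap even = Ideal.span {a} := by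
  ext b
  rw [Ideal.mem_comap, Ideal.mem_span_singleton, Ideal.mem_span_singleton]
  refine ⟨fun ⟨f, hf⟩ ↦ ?_, map_dvd even⟩
  rcases eq_or_ne a 0 with rfl | ha
  · rw [map_zero, zero_mul] at hf
    exact (even_injective (hf.trans (map_zero even).symm)).symm.dvd
  have hf_even : negVars f = f := by
    refine mul_left_cancel₀ ((map_ne_zero_iff even even_injective).2 ha) ?_
    rw [← hf, ← negVars_even b, hf, map_mul, negVars_even]
  obtain ⟨c, rfl⟩ := exists_eq_even_of_negVars_eq hf_even
  exact ⟨c, even_injective (by rw [hf, map_mul])⟩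

lemma negVars_eq_neg_of_even_eq_mul {f g : P} {a : A} (hg₀ : g ≠ 0) (hg : negVars g = -g)
    (h : even a = g * f) : negVars f = -f := by
  refine mul_left_cancel₀ hg₀ ?_
  rw [mul_neg, ← h, ← negVars_even a, h, map_mul, hg, neg_mul, neg_neg]

lemma span_x_mul_comap_even_span {g : P} (hg₀ : g ≠ 0) (hg : negVars g = -g) {b : A}
    (hb : even b = X 0 * g) :
    Ideal.span {x} * (Ideal.span {g}).comap even = Ideal.span {b} * ruling := by
  refine le_antisymm (fun c hc ↦ ?_) (fun c hc ↦ ?_)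
  · obtain ⟨a, ha, rfl⟩ := Ideal.mem_span_singleton_mul.1 hc
    obtain ⟨f, hf⟩ := Ideal.mem_span_singleton.1 ha
    have hf_odd := negVars_eq_neg_of_even_eq_mul hg₀ hg hf
    obtain ⟨i, hi⟩ := exists_eq_even_of_negVars_eq (f := X 0 * f) (by
      rw [map_mul, negVars_X0, hf_odd, neg_mul_neg])
    refine Ideal.mem_span_singleton_mul.2 ⟨i, mem_ruling_iff_dvd.2 ⟨f, hi.symm⟩, even_injective ?_⟩
    rw [map_mul, map_mul, even_x, hf, hb, ← hi]
    ring
  · obtain ⟨a, ha, rfl⟩ := Ideal.mem_span_singleton_mul.1 hc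
    obtain ⟨f, hf⟩ := mem_ruling_iff_dvd.1 ha
    have hf_odd := negVars_eq_neg_of_even_eq_mul (X_ne_zero 0) negVars_X0 hf
    obtain ⟨d, hd⟩ := exists_eq_even_of_negVars_eq (f := g * f) (by
      rw [map_mul, hg, hf_odd, neg_mul_neg])
    refine Ideal.mem_span_singleton_mul.2
      ⟨d, Ideal.mem_span_singleton.2 ⟨f, hd.symm⟩, even_injective ?_⟩
    rw [map_mul, map_mul, even_x, hf, hb, ← hd]
    ring

lemma negVars_eq_or_eq_neg_of_dvd {g : P} (h : g ∣ negVars g) :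
    negVars g = g ∨ negVars g = -g := by
  rcases eq_or_ne g 0 with rfl | hg
  · exact .inl (map_zero _)
  obtain ⟨c, hc⟩ := h
  have hinv : c * negVars c = 1 := by
    have hcc := congrArg negVars hc
    rw [negVars_negVars, map_mul, hc] at hcc
    exact mul_left_cancel₀ hg (by linear_combination -hcc)
  obtain ⟨r, -, rfl⟩ := isUnit_iff_eq_C_of_isReduced.1 (IsUnit.of_mul_eq_one _ hinv)
  have hr : r * r = 1 := by
    rw [← algebraMap_eq, AlgHom.commutes, ← map_mul] at hinv
    exact (algebraMap ℂ P).injective (hinv.trans (map_one _).symm)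
  rcases mul_self_eq_one_iff.1 hr with rfl | rfl
  · exact .inl (by simp [hc])
  · exact .inr (by simp [hc])

lemma comap_even_span_mul_negVars {g : P} (hg : Prime g) (h : ¬ g ∣ negVars g) :
    (Ideal.span {g * negVars g}).comap even = (Ideal.span {g}).comap even := by
  refine le_antisymm (Ideal.comap_mono (Ideal.span_singleton_le_span_singleton.2 ⟨_, rfl⟩)) ?_
  intro a ha
  obtain ⟨f, hf⟩ := Ideal.mem_span_singleton.1 ha
  have hdvd : g ∣ negVars g * negVars f := ⟨f, by rw [← map_mul, ← hf, negVars_even]⟩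
  have hneg := map_dvd negVars ((hg.dvd_or_dvd hdvd).resolve_left h)
  rw [negVars_negVars] at hneg
  exact Ideal.mem_span_singleton.2 (hf ▸ mul_dvd_mul_left g hneg)

lemma nonempty_equiv_or_of_not_isMaximal {p : Ideal A} [p.IsPrime] (hp₀ : p ≠ ⊥)
    (hp : ¬ p.IsMaximal) : Nonempty (A ≃ₗ[A] p) ∨ Nonempty (ruling ≃ₗ[A] p) := by
  obtain ⟨g, hg, rfl⟩ := exists_prime_comap_even_eq hp₀ hp
  have free_of_negVars_eq {f : P} (hf : negVars f = f)
      (hspan : (Ideal.span {f}).comap even = (Ideal.span {g}).comap even) :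
      Nonempty (A ≃ₗ[A] ↥((Ideal.span {g}).comap even)) := by
    obtain ⟨a, rfl⟩ := exists_eq_even_of_negVars_eq hf
    rw [comap_even_span_even] at hspan
    have ha : a ≠ 0 := by
      rintro rfl
      exact hp₀ (hspan ▸ Ideal.span_singleton_zero)
    exact ⟨LinearEquiv.toSpanNonzeroSingleton A A a ha ≪≫ₗ LinearEquiv.ofEq _ _ hspan⟩
  by_cases hdvd : g ∣ negVars g
  · rcases negVars_eq_or_eq_neg_of_dvd hdvd with heven | hodd
    · exact .inl (free_of_negVars_eq heven rfl)
    · obtain ⟨b, hb⟩ := exists_eq_even_of_negVars_eq (f := X 0 * g) (by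
        rw [map_mul, hodd, negVars_X0, neg_mul_neg])
      have hb₀ : b ≠ 0 := by
        rintro rfl
        exact mul_ne_zero (X_ne_zero 0) hg.ne_zero (hb.trans (map_zero even))
      exact .inr (nonempty_linearEquiv_of_span_mul_eq hb₀ x_ne_zero
        (span_x_mul_comap_even_span hg.ne_zero hodd hb.symm).symm)
  · exact .inl (free_of_negVars_eq (f := g * negVars g)
      (by rw [map_mul, negVars_negVars, mul_comm]) (comap_even_span_mul_negVars hg hdvd))

end Primes

section Devissage

universe u

/-- A property of finitely generated `R`-modules that holds for zero modules and is stable under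
extensions and under cokernels of injective maps. By devissage it is enough to check such a
property on the quotients of `R` by prime ideals. -/
structure IsDevissage {R : Type u} [CommRing R]
    (Θ : (N : Type u) → [AddCommGroup N] → [Module R N] → [Module.Finite R N] → Prop) : Prop where
  of_subsingleton (N : Type u) [AddCommGroup N] [Module R N] [Module.Finite R N] [Subsingleton N] :
    Θ N
  middle {N₁ N₂ N₃ : Type u} [AddCommGroup N₁] [Module R N₁] [Module.Finite R N₁]
    [AddCommGroup N₂] [Module R N₂] [Module.Finite R N₂] [AddCommGroup N₃] [Module R N₃]
    [Module.Finite R N₃] {f : N₁ →ₗ[R] N₂} {g : N₂ →ₗ[R] N₃} (hf : Function.Injective f)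
    (hg : Function.Surjective g) (hfg : Function.Exact f g) : Θ N₁ → Θ N₃ → Θ N₂
  right {N₁ N₂ N₃ : Type u} [AddCommGroup N₁] [Module R N₁] [Module.Finite R N₁]
    [AddCommGroup N₂] [Module R N₂] [Module.Finite R N₂] [AddCommGroup N₃] [Module R N₃]
    [Module.Finite R N₃] {f : N₁ →ₗ[R] N₂} {g : N₂ →ₗ[R] N₃} (hf : Function.Injective f)
    (hg : Function.Surjective g) (hfg : Function.Exact f g) : Θ N₁ → Θ N₂ → Θ N₃

lemma exact_lsmul_factor {R : Type*} [CommRing R] (I : Ideal R) (f : R) :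
    Function.Exact (LinearMap.lsmul R (R ⧸ I) f)
      (Submodule.factor (le_sup_left : I ≤ I ⊔ Ideal.span {f})) := by
  intro m
  obtain ⟨a, rfl⟩ := Ideal.Quotient.mk_surjective m
  change Ideal.Quotient.mk (I ⊔ Ideal.span {f}) a = 0 ↔ _
  rw [Ideal.Quotient.eq_zero_iff_mem, sup_comm, Ideal.mem_span_singleton_sup]
  constructor
  · rintro ⟨b, c, hc, rfl⟩
    refine ⟨Ideal.Quotient.mk I b, Ideal.Quotient.eq.2 ?_⟩
    change f * b - (b * f + c) ∈ I
    rw [mul_comm f, sub_add_cancel_left]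
    exact I.neg_mem hc
  · rintro ⟨n, hn⟩
    obtain ⟨b, rfl⟩ := Ideal.Quotient.mk_surjective n
    exact ⟨b, a - f * b, Ideal.Quotient.eq.1 hn.symm, by ring⟩

lemma lsmul_quotient_injective {R : Type*} [CommRing R] (p : Ideal R) [p.IsPrime] {f : R}
    (hf : f ∉ p) : Function.Injective (LinearMap.lsmul R (R ⧸ p) f) := fun m n h ↦ by
  simp only [LinearMap.lsmul_apply, Algebra.smul_def] at h
  exact mul_left_cancel₀ (mt Ideal.Quotient.eq_zero_iff_mem.1 hf) h

namespace IsDevissage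

variable {R : Type u} [CommRing R]
  {Θ : (N : Type u) → [AddCommGroup N] → [Module R N] → [Module.Finite R N] → Prop}

lemma of_equiv (h : IsDevissage Θ) {N M : Type u} [AddCommGroup N] [Module R N] [Module.Finite R N]
    [AddCommGroup M] [Module R M] [Module.Finite R M] (e : N ≃ₗ[R] M) (hN : Θ N) : Θ M :=
  h.middle e.injective (Function.surjective_to_subsingleton (0 : M →ₗ[R] PUnit.{u + 1}))
    ((e.exact_zero_iff_surjective _).2 e.surjective) hN (h.of_subsingleton _)

lemma quotient (h : IsDevissage Θ) (hR : Θ R) (I : Ideal R) [Module.Finite R I] (hI : Θ I) :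
    Θ (R ⧸ I) :=
  h.right Subtype.val_injective I.mkQ_surjective (LinearMap.exact_subtype_mkQ I) hI hR

lemma quotient_sup_span (h : IsDevissage Θ) (p : Ideal R) [p.IsPrime] {f : R} (hf : f ∉ p)
    (hp : Θ (R ⧸ p)) : Θ (R ⧸ (p ⊔ Ideal.span {f})) :=
  h.right (lsmul_quotient_injective p hf) (Submodule.factor_surjective le_sup_left)
    (exact_lsmul_factor p f) hp hp

lemma of_forall_prime [IsNoetherianRing R] (h : IsDevissage Θ)
    (hprime : ∀ (p : Ideal R) [p.IsPrime], Θ (R ⧸ p)) (N : Type u) [AddCommGroup N] [Module R N]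
    [hN : Module.Finite R N] : Θ N :=
  IsNoetherianRing.induction_on_isQuotientEquivQuotientPrime R hN (motive := fun N _ _ _ ↦ Θ N)
    (fun N _ _ _ _ ↦ h.of_subsingleton N) (fun _ _ _ _ p e ↦ h.of_equiv e.symm (hprime p.asIdeal))
    (fun _ _ _ _ _ _ _ _ _ _ _ _ _ _ hf hg hfg ↦ h.middle hf hg hfg)

end IsDevissage

lemma exists_algHom_ker_eq_of_isMaximal (k : Type*) {S : Type*} [Field k] [IsAlgClosed k]
    [CommRing S] [Algebra k S] [Algebra.FiniteType k S] (m : Ideal S) [m.IsMaximal] :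
    ∃ ψ : S →ₐ[k] k, RingHom.ker ψ = m := by
  let _ : Field (S ⧸ m) := Ideal.Quotient.field m
  have _ : Algebra.FiniteType k (S ⧸ m) :=
    .of_surjective (Ideal.Quotient.mkₐ k m) Ideal.Quotient.mk_surjective
  have _ : Module.Finite k (S ⧸ m) := finite_of_finite_type_of_isJacobsonRing k (S ⧸ m)
  let e : k ≃ₐ[k] (S ⧸ m) := .ofBijective (Algebra.ofId k (S ⧸ m))
    IsAlgClosed.algebraMap_bijective_of_isIntegral
  refine ⟨(e.symm : (S ⧸ m) →ₐ[k] k).comp (Ideal.Quotient.mkₐ k m), Ideal.ext fun a ↦ ?_⟩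
  rw [RingHom.mem_ker, ← Ideal.Quotient.eq_zero_iff_mem]
  exact EmbeddingLike.map_eq_zero_iff (f := e.symm)

/-- The homomorphism `A → ℂ[T]` restricting functions to the line through the origin and the
point `(a, b, c)` of the cone. -/
def line (a b c : ℂ) (h : b ^ 2 = a * c) : A →ₐ[ℂ] Polynomial ℂ :=
  conePoint (a • Polynomial.X) (b • Polynomial.X) (c • Polynomial.X) (by
    rw [smul_pow, h, smul_mul_smul_comm, pow_two])

lemma line_surjective {a b c : ℂ} (h : b ^ 2 = a * c) (h₀ : a ≠ 0 ∨ c ≠ 0) :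
    Function.Surjective (line a b c h) := by
  rw [← AlgHom.range_eq_top, eq_top_iff, ← Polynomial.adjoin_X, Algebra.adjoin_le_iff,
    Set.singleton_subset_iff]
  rcases h₀ with h₀ | h₀
  · exact ⟨a⁻¹ • x, by simp [line, smul_smul, h₀]⟩
  · exact ⟨c⁻¹ • w, by simp [line, smul_smul, h₀]⟩

lemma exists_eq_aeval_comp_line (ψ : A →ₐ[ℂ] ℂ) :
    ∃ (l : A →ₐ[ℂ] Polynomial ℂ) (r : ℂ), Function.Surjective l ∧
      ψ = (Polynomial.aeval r).comp l := by
  have hψ : ψ y ^ 2 = ψ x * ψ w := by rw [← map_pow, y_sq, map_mul]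
  by_cases h₀ : ψ x ≠ 0 ∨ ψ w ≠ 0
  · exact ⟨line _ _ _ hψ, 1, line_surjective hψ h₀,
      algHom_ext_cone (by simp [line]) (by simp [line]) (by simp [line])⟩
  · push Not at h₀
    have hy : ψ y = 0 := by simpa [h₀.1] using hψ
    exact ⟨line 1 0 0 (by simp), 0, line_surjective _ (.inl one_ne_zero),
      algHom_ext_cone (by simp [line, h₀.1]) (by simp [line, hy]) (by simp [line, h₀.2])⟩

lemma exists_eq_sup_span_of_isMaximal (m : Ideal A) [m.IsMaximal] :
    ∃ (p : Ideal A) (f : A), p.IsPrime ∧ ¬ p.IsMaximal ∧ f ∉ p ∧ m = p ⊔ Ideal.span {f} := by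
  obtain ⟨ψ, rfl⟩ := exists_algHom_ker_eq_of_isMaximal ℂ m
  obtain ⟨l, r, hl, rfl⟩ := exists_eq_aeval_comp_line ψ
  obtain ⟨f, hf⟩ := hl (Polynomial.X - Polynomial.C r)
  refine ⟨RingHom.ker l, f, RingHom.ker_isPrime _, fun hmax ↦ ?_, ?_, ?_⟩
  · have hfield : IsField (Polynomial ℂ) :=
      MulEquiv.isField ((Ideal.Quotient.maximal_ideal_iff_isField_quotient _).1 hmax)
        (RingHom.quotientKerEquivOfSurjective hl).symm.toMulEquiv
    exact Polynomial.not_isField ℂ hfield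
  · rw [RingHom.mem_ker, hf]
    exact Polynomial.X_sub_C_ne_zero r
  · ext a
    rw [sup_comm, Ideal.mem_span_singleton_sup, RingHom.mem_ker, AlgHom.comp_apply,
      Polynomial.coe_aeval_eq_eval, ← Polynomial.IsRoot.def, ← Polynomial.dvd_iff_isRoot, ← hf]
    refine ⟨fun ⟨g, hg⟩ ↦ ?_, ?_⟩
    · obtain ⟨b, rfl⟩ := hl g
      refine ⟨b, a - b * f, ?_, by ring⟩
      rw [RingHom.mem_ker, map_sub, map_mul, hg, mul_comm, sub_self]
    · rintro ⟨b, c, hc, rfl⟩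
      exact ⟨l b, by rw [map_add, map_mul, RingHom.mem_ker.1 hc, add_zero, mul_comm]⟩

theorem IsDevissage.of_free_of_ruling
    {Θ : (N : Type) → [AddCommGroup N] → [Module A N] → [Module.Finite A N] → Prop}
    (h : IsDevissage Θ) (hA : Θ A) (hr : Θ ruling) (N : Type) [AddCommGroup N] [Module A N]
    [Module.Finite A N] : Θ N := by
  have of_not_isMaximal (p : Ideal A) [p.IsPrime] (hp : ¬ p.IsMaximal) : Θ (A ⧸ p) := by
    refine h.quotient hA p ?_
    rcases eq_or_ne p ⊥ with rfl | hp₀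
    · exact h.of_subsingleton _
    obtain ⟨⟨e⟩⟩ | ⟨⟨e⟩⟩ := nonempty_equiv_or_of_not_isMaximal hp₀ hp
    · exact h.of_equiv e hA
    · exact h.of_equiv e hr
  refine h.of_forall_prime (fun p _ ↦ ?_) N
  by_cases hp : p.IsMaximal
  · obtain ⟨q, f, _, hq, hf, rfl⟩ := exists_eq_sup_span_of_isMaximal p
    exact h.quotient_sup_span q hf (of_not_isMaximal q hq)
  · exact of_not_isMaximal p hp

end Devissage

section Resolution

instance : Module.Finite (CommRingCat.of A) ruling := inferInstanceAs (Module.Finite A ruling)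

/-- `F` is the sheaf associated with the ideal `(x, y)`. -/
def tildeRulingIso : tilde (ModuleCat.of (CommRingCat.of A) ruling) ≅ F :=
  tildeIso (R := CommRingCat.of A) F (LinearEquiv.toModuleIso (R := CommRingCat.of A) rulingEquiv)

lemma isCoherent_F : isCoherent X₂ F :=
  isCoherent_of_iso tildeRulingIso (isCoherent_tilde _)

lemma rank_F : rank F = 1 :=
  rulingEquiv.rank_eq.symm.trans rank_ruling

lemma exists_resolution_F : ∃ (ε : O₂ ⟶ F) (h₀ : φ ≫ ε = 0) (h₁ : φ ≫ φ = 0),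
    Epi ε ∧ (ShortComplex.mk φ ε h₀).Exact ∧ (ShortComplex.mk φ φ h₁).Exact :=
  exists_periodic_resolution tildeRulingIso
    (ModuleCat.ofHom (R := CommRingCat.of A) factorization)
    (ModuleCat.ofHom (R := CommRingCat.of A) rulingCover)
    exact_factorization exact_factorization_rulingCover rulingCover_surjective

end Resolution

section LocallyFree

universe u

lemma isIso_ofEpi_π {C : Type*} [Category C] {J : GrothendieckTopology C} {S : Sheaf J RingCat}
    [HasWeakSheafify J AddCommGrpCat] [J.WEqualsLocallyBijective AddCommGrpCat]
    {M N : SheafOfModules S} {σ : M.GeneratingSections} {p : M ⟶ N} {epi_p : Epi p} (hσ : IsIso σ.π)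
    (hp : IsIso p) : IsIso (σ.ofEpi p).π := by
  rw [SheafOfModules.GeneratingSections.ofEpi_π]
  exact IsIso.comp_isIso' hσ hp

lemma isIso_map_π {C D : Type*} [Category C] [Category D] {J : GrothendieckTopology C}
    {K : GrothendieckTopology D} {S : Sheaf J RingCat.{u}} {T : Sheaf K RingCat.{u}}
    [HasWeakSheafify J AddCommGrpCat.{u}] [J.WEqualsLocallyBijective AddCommGrpCat.{u}]
    [HasSheafify K AddCommGrpCat.{u}] [K.WEqualsLocallyBijective AddCommGrpCat.{u}]
    {M : SheafOfModules.{u} S} (σ : M.GeneratingSections) [IsIso σ.π]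
    (G : SheafOfModules.{u} S ⥤ SheafOfModules.{u} T) (_ : PreservesColimitsOfSize.{u, u} G)
    (η : SheafOfModules.unit T ≅ G.obj (SheafOfModules.unit S)) : IsIso (σ.map G η).π :=
  inferInstance

lemma isLocallyFree_of_iso {C : Type*} [Category C] {J : GrothendieckTopology C}
    {S : Sheaf J RingCat} [∀ X, HasWeakSheafify (J.over X) AddCommGrpCat]
    [∀ X, (J.over X).WEqualsLocallyBijective AddCommGrpCat] {M N : SheafOfModules S}
    (e : M ≅ N) (hM : M.IsLocallyFree) : N.IsLocallyFree := by
  obtain ⟨q, hq⟩ := hM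
  let restrict_hom (i : q.I) : M.over (q.X i) ⟶ N.over (q.X i) :=
    (SheafOfModules.overFunctor S (q.X i)).map e.hom
  have isIso_restrict_hom (i : q.I) : IsIso (restrict_hom i) :=
    Functor.map_isIso (SheafOfModules.overFunctor S (q.X i)) e.hom
  let q' : N.LocalGeneratorsData :=
    { I := q.I
      X := q.X
      coversTop := q.coversTop
      generators i := (q.generators i).ofEpi (restrict_hom i) }
  exact ⟨q', ⟨fun i ↦ isIso_ofEpi_π (epi_p := inferInstance) (hq.isIso i) (isIso_restrict_hom i)⟩⟩

lemma isIso_restrictGenerators_π {X Y : Scheme.{0}} (M : X.Modules) (W : X.Opens) (f : Y ⟶ X)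
    [IsOpenImmersion f] (h : f.opensRange ≤ W) (G : (M.over W).GeneratingSections)
    [IsIso G.π] : IsIso (restrictGenerators M W f h G).π := by
  unfold restrictGenerators
  exact isIso_ofEpi_π (isIso_map_π _ _ _ _) (Iso.isIso_hom _)

variable {R : CommRingCat.{0}}

lemma projective_of_isIso_π (G : (Spec R).Modules) [G.IsQuasicoherent]
    (σ : G.GeneratingSections) [IsIso σ.π] : Module.Projective R (secTop G) := by
  let N := (moduleSpecΓFunctor (R := R)).obj G
  let free_iso : (tilde.functor R).obj (ModuleCat.of R (σ.I →₀ R)) ≅ (tilde.functor R).obj N :=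
    tildeFinsupp σ.I ≪≫ @asIso _ _ _ _ σ.π ‹_› ≪≫ (tildeIso G (Iso.refl N)).symm
  exact Module.Projective.of_equiv ((tilde.functor R).preimageIso free_iso).toLinearEquiv

lemma flat_of_addEquiv_localization {R S Q N : Type*} [CommRing R] [CommRing S] (a : R)
    [Algebra R S] [IsLocalization.Away a S] [AddCommGroup Q] [Module R Q]
    [AddCommGroup N] [Module S N] [Module.Flat S N] (e : N ≃+ Q)
    (he : ∀ (r : R) (n : N), e (algebraMap R S r • n) = r • e n) : Module.Flat R Q := by
  let _ : Module R N := Module.compHom N (algebraMap R S)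
  have : IsScalarTower R S N := .of_algebraMap_smul fun _ _ ↦ rfl
  let e' : N ≃ₗ[R] Q := { e with map_smul' := he }
  have : Module.Flat R S := IsLocalization.flat S (.powers a)
  have : Module.Flat R N := .trans R S N
  exact Module.Flat.of_linearEquiv e'.symm

lemma span_setOf_dopen_le_eq_top {ι : Type*} {U : ι → (Spec R).Opens} (hU : IsOpenCover U) :
    Ideal.span {a : R | ∃ i, dopen a ≤ U i} = ⊤ := by
  rw [← PrimeSpectrum.zeroLocus_empty_iff_eq_top, PrimeSpectrum.zeroLocus_span,
    Set.eq_empty_iff_forall_notMem]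
  intro p hp
  obtain ⟨i, hi⟩ := hU.exists_mem p
  obtain ⟨_, ⟨_, ⟨a, rfl⟩, rfl⟩, hpa, ha⟩ :=
    PrimeSpectrum.isBasis_basic_opens.exists_subset_of_mem_open hi (U i).2
  exact hpa (hp ⟨i, ha⟩)

lemma flat_secD (G : (Spec R).Modules) [hG : G.IsQuasicoherent] (W : (Spec R).Opens)
    (σ : (G.over W).GeneratingSections) [IsIso σ.π] (a : R) (ha : dopen a ≤ W) :
    Module.Flat R (secD G a) := by
  have range_le : (Spec.map (awayMap R a)).opensRange ≤ W := by
    rwa [← Scheme.Hom.image_top_eq_opensRange, image_awayMap]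
  have := isQuasicoherent_restrict (Spec.map (awayMap R a)) G hG
  have := isIso_restrictGenerators_π G W _ range_le σ
  have : Module.Projective (awayRing R a) (secTop (G.restrict (Spec.map (awayMap R a)))) :=
    projective_of_isIso_π _ (restrictGenerators G W _ range_le σ)
  exact flat_of_addEquiv_localization (S := awayRing R a) a (sectionsAway G a)
    (sectionsAway_smul G a)

lemma flat_of_isLocallyFree (G : (Spec R).Modules) [hG : G.IsQuasicoherent]
    (hfree : SheafOfModules.IsLocallyFree G) : Module.Flat R (secTop G) := by
  obtain ⟨q, hq⟩ := hfree
  let t : Set R := {a | ∃ i, dopen a ≤ q.X i}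
  have localized (a : R) := (isIso_fromTildeΓ_iff_isLocalizing G).1
    ((isQuasicoherent_iff_isIso_fromTildeΓ G).1 hG) a
  have flat_away : ∀ a : t, Module.Flat R (secD G a) := by
    rintro ⟨a, i, hi⟩
    have := hq.isIso i
    exact flat_secD G (q.X i) (q.generators i) a hi
  exact @Module.flat_of_isLocalized_span R R _ _ _ (secTop G) _ _ _ _ t
    (span_setOf_dopen_le_eq_top ((Opens.coversTop_iff _ _).1 q.coversTop))
    (fun a ↦ secD G a) _ _ _ _ _ (fun a ↦ localized a) flat_away

lemma projective_secTop_of_isLocallyFree [IsNoetherianRing R] {G : (Spec R).Modules}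
    (hG : isCoherent (Spec R) G) (hfree : SheafOfModules.IsLocallyFree G) :
    Module.Projective R (secTop G) := by
  have := hG.1
  have := flat_of_isLocallyFree G hfree
  have := finite_of_isCoherent G hG
  have := Module.finitePresentation_of_finite R (secTop G)
  exact Module.Flat.projective_of_finitePresentation

end LocallyFree

section CoherentModules

variable {R : CommRingCat.{0}}

/-- The coherent sheaf associated with a finitely generated module. -/
abbrev cohOf (R : CommRingCat.{0}) (N : Type) [AddCommGroup N] [Module R N] [Module.Finite R N] :
    Coh R :=
  (tildeFG R).obj (FGModuleCat.of R N)

variable {M N L : Type} [AddCommGroup M] [Module R M] [Module.Finite R M]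
  [AddCommGroup N] [Module R N] [Module.Finite R N] [AddCommGroup L] [Module R L]
  [Module.Finite R L]

/-- The morphism of coherent sheaves associated with a linear map. -/
abbrev cohMap (f : M →ₗ[R] N) : cohOf R M ⟶ cohOf R N := (tildeFG R).map (FGModuleCat.ofHom f)

variable [IsNoetherianRing R]

instance : (tildeFG R).Additive := Functor.additive_of_preserves_binary_products _

lemma cohMap_comp_eq_zero {f : M →ₗ[R] N} {g : N →ₗ[R] L} (h : g ∘ₗ f = 0) :
    cohMap f ≫ cohMap g = 0 := by
  rw [← Functor.map_comp]
  exact (congrArg (tildeFG R).map (FGModuleCat.hom_ext h)).trans ((tildeFG R).map_zero _ _)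

lemma shortExact_cohMap {f : M →ₗ[R] N} {g : N →ₗ[R] L} (hf : Function.Injective f)
    (hg : Function.Surjective g) (hfg : Function.Exact f g) :
    (ShortComplex.mk (cohMap f) (cohMap g)
      (cohMap_comp_eq_zero hfg.linearMap_comp_eq_zero)).ShortExact := by
  let U := forget₂ (FGModuleCat R) (ModuleCat R)
  let S : ShortComplex (FGModuleCat R) := ShortComplex.mk (FGModuleCat.ofHom f)
    (FGModuleCat.ofHom g) (FGModuleCat.hom_ext hfg.linearMap_comp_eq_zero)
  have hS : S.ShortExact :=
    { exact := (S.exact_map_iff_of_faithful U).1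
        ((ShortComplex.ShortExact.moduleCat_exact_iff_function_exact _).2 hfg)
      mono_f := U.mono_of_mono_map ((ModuleCat.mono_iff_injective _).2 hf)
      epi_g := U.epi_of_epi_map ((ModuleCat.epi_iff_surjective _).2 hg) }
  exact hS.map_of_exact (tildeFG R)

lemma projective_cohOf (N : Type) [AddCommGroup N] [Module R N] [Module.Finite R N]
    [Module.Projective R N] : Projective (cohOf R N) := by
  refine ((tildeFG R).asEquivalence.map_projective_iff (FGModuleCat.of R N)).2 ?_
  exact (forget₂ (FGModuleCat R) (ModuleCat R)).projective_of_map_projective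
    ((IsProjective.iff_projective N).1 inferInstance)

lemma projective_of_projective_cohOf (N : Type) [AddCommGroup N] [Module R N]
    [Module.Finite R N] [Projective (cohOf R N)] : Module.Projective R N := by
  obtain ⟨n, g, hg⟩ := Module.Finite.exists_fin' R N
  have : Projective (FGModuleCat.of R N) :=
    ((tildeFG R).asEquivalence.map_projective_iff (FGModuleCat.of R N)).1 ‹_›
  have : Epi (FGModuleCat.ofHom g) :=
    (forget₂ (FGModuleCat R) (ModuleCat R)).epi_of_epi_map ((ModuleCat.epi_iff_surjective _).2 hg)
  let s : FGModuleCat.of R N ⟶ FGModuleCat.of R (Fin n → R) :=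
    Projective.factorThru (𝟙 _) (FGModuleCat.ofHom g)
  have hs : s ≫ FGModuleCat.ofHom g = 𝟙 _ := Projective.factorThru_comp _ _
  exact .of_split s.hom.hom g (congrArg (fun k ↦ k.hom.hom) hs)

lemma projective_of_isLocallyFree (G : Coh R) (hG : SheafOfModules.IsLocallyFree G.obj) :
    Projective G := by
  have := G.property.1
  have := finite_of_isCoherent G.obj G.property
  have : Module.Projective R (secTop G.obj) := projective_secTop_of_isLocallyFree G.property hG
  exact Projective.of_iso ((isCoherent (Spec R)).isoMk (tildeIso G.obj (Iso.refl _)))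
    (projective_cohOf (secTop G.obj))

end CoherentModules

section Derived

open Pretriangulated DerivedCategory ZeroObject

universe w

variable {C : Type*} [Category C] [Abelian C] [HasDerivedCategory.{w} C]

lemma hom_eq_zero_of_projective (P : CochainComplex C ℤ) (a b m : ℤ) [P.IsStrictlyGE a]
    [P.IsStrictlyLE b] (hP : ∀ n, Projective (P.X n)) (hm : m < a) {Y : DerivedCategory C}
    [Y.IsLE m] (f : Q.obj P ⟶ Y) : f = 0 := by
  obtain ⟨K, _, ⟨e⟩⟩ := exists_iso_Q_obj_of_isLE Y m
  have : P.IsKProjective := CochainComplex.isKProjective_of_projective P b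
  obtain ⟨g, hg⟩ := (CochainComplex.IsKProjective.Qh_map_bijective P
    ((HomotopyCategory.quotient _ _).obj K)).surjective
      ((quotientCompQhIso C).hom.app P ≫ f ≫ e.hom ≫ (quotientCompQhIso C).inv.app K)
  obtain ⟨h, rfl⟩ := (HomotopyCategory.quotient C (.up ℤ)).map_surjective g
  have h_eq_zero : h = 0 := by
    ext i
    by_cases hi : i < a
    · exact (P.isZero_of_isStrictlyGE a i hi).eq_of_src _ _
    · exact (K.isZero_of_isStrictlyLE m i (by lia)).eq_of_tgt _ _
  rw [h_eq_zero, Functor.map_zero, Functor.map_zero] at hg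
  rw [← cancel_mono e.hom, ← cancel_mono ((quotientCompQhIso C).inv.app K),
    ← cancel_epi ((quotientCompQhIso C).hom.app P)]
  simp only [Category.assoc, ← hg, zero_comp, comp_zero]

variable (C) in
/-- The objects of finite projective dimension of the derived category: those without nonzero
morphisms to objects concentrated in sufficiently low degrees. -/
def finiteProjectiveDimension : ObjectProperty (DerivedCategory C) := fun K ↦
  ∃ a : ℤ, ∀ (Y : DerivedCategory C) (_ : Y.IsLE a) (f : K ⟶ Y), f = 0

instance : (finiteProjectiveDimension C).IsStableUnderRetracts where
  of_retract {X Y} r := by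
    rintro ⟨a, ha⟩
    refine ⟨a, fun Z hZ f ↦ ?_⟩
    rw [← Category.id_comp f, ← r.retract, Category.assoc, ha Z hZ (r.r ≫ f), comp_zero]

instance : (finiteProjectiveDimension C).IsTriangulated where
  exists_zero := ⟨0, isZero_zero _, 0, fun _ _ _ ↦ (isZero_zero _).eq_of_src _ _⟩
  isStableUnderShiftBy n :=
    ⟨by
      rintro K ⟨a, ha⟩
      refine ⟨a - n, fun Y hY f ↦ (shiftFunctor _ (-n)).map_injective ?_⟩
      have isLE_shift := TStructure.t.isLE_shift Y (a - n) (-n) a (by lia)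
      let e : K ≅ K⟦n⟧⟦-n⟧ := (shiftEquiv (DerivedCategory C) n).unitIso.app K
      rw [← cancel_epi e.hom, Functor.map_zero, comp_zero]
      exact ha _ isLE_shift _⟩
  ext₂' T hT := by
    rintro ⟨a, ha⟩ ⟨b, hb⟩
    refine ObjectProperty.le_isoClosure _ _ ⟨min a b, fun Y hY f ↦ ?_⟩
    obtain ⟨g, rfl⟩ := T.yoneda_exact₂ hT f
      (ha Y (TStructure.t.isLE_of_le Y _ a (min_le_left a b)) _)
    rw [hb Y (TStructure.t.isLE_of_le Y _ b (min_le_right a b)) g, comp_zero]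

lemma finiteProjectiveDimension_Q_obj (P : CochainComplex C ℤ) (a b : ℤ) [P.IsStrictlyGE a]
    [P.IsStrictlyLE b] (hP : ∀ n, Projective (P.X n)) :
    finiteProjectiveDimension C (Q.obj P) :=
  ⟨a - 1, fun _ _ f ↦ hom_eq_zero_of_projective P a b (a - 1) hP (by lia) f⟩

lemma exists_hasProjectiveDimensionLT {X : C}
    (hX : finiteProjectiveDimension C ((singleFunctor C 0).obj X)) :
    ∃ n, HasProjectiveDimensionLT X n := by
  have := hasExt_of_hasDerivedCategory.{w} C
  obtain ⟨a, ha⟩ := hX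
  refine ⟨a.natAbs, HasProjectiveDimensionLT.mk fun i hi Y α ↦ Abelian.Ext.ext ?_⟩
  have isLE_shift := TStructure.t.isLE_shift ((singleFunctor C 0).obj Y) 0 i (-i) (by lia)
  have isLE := TStructure.t.isLE_of_le (((singleFunctor C 0).obj Y)⟦(i : ℤ)⟧) (-i) a (by lia)
  exact (ha _ isLE _).trans (ha _ isLE _).symm

lemma prop_of_bounded (W : ObjectProperty (DerivedCategory C)) [W.IsTriangulated]
    [W.IsClosedUnderIsomorphisms] (hW : ∀ X : C, W ((singleFunctor C 0).obj X))
    (K : DerivedCategory C) (hK : TStructure.t.bounded K) : W K := by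
  have prop_single (n : ℤ) (X : C) : W ((singleFunctor C n).obj X) :=
    W.prop_of_iso (((singleFunctors C).shiftIso (-n) n 0 (by lia)).app X) (W.le_shift (-n) _ (hW X))
  obtain ⟨⟨a, ha⟩, ⟨b, hb⟩⟩ := hK
  have prop_of_amplitude (n : ℕ) :
      ∀ K : DerivedCategory C, K.IsGE a → K.IsLE (a + n - 1) → W K := by
    induction n with
    | zero =>
      intro K _ _
      exact W.prop_of_isZero (TStructure.t.isZero K (a + (0 : ℕ) - 1) a (by simp))
    | succ n ih =>
      intro K _ hKn
      let K_top := (TStructure.t.truncGE (a + n)).obj K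
      have : K_top.IsLE (a + n) :=
        have := TStructure.t.isLE_of_le K (a + (n + 1 : ℕ) - 1) (a + n) (by push_cast; lia)
        inferInstance
      obtain ⟨Y, ⟨e⟩⟩ := exists_iso_singleFunctor_obj_of_isGE_of_isLE K_top (a + n)
      exact W.ext_of_isTriangulatedClosed₂ _
        (TStructure.t.triangleLEGE_distinguished (a + n - 1) (a + n) (by lia) K)
        (ih ((TStructure.t.truncLE (a + n - 1)).obj K) inferInstance inferInstance)
        (W.prop_of_iso e.symm (prop_single _ Y))
  exact prop_of_amplitude (b - a + 1).toNat K ha (TStructure.t.isLE_of_le K b _ (by lia))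

end Derived

lemma projective_of_hasProjectiveDimensionLT {C : Type*} [Category C] [Abelian C]
    {S : ShortComplex C} (hS : S.ShortExact) [Projective S.X₂] (e : S.X₁ ≅ S.X₃) {n : ℕ}
    (hn : HasProjectiveDimensionLT S.X₃ (n + 1)) : Projective S.X₃ := by
  induction n with
  | zero => exact projective_iff_hasProjectiveDimensionLT_one.2 hn
  | succ n ih =>
    have := (hS.hasProjectiveDimensionLT_X₃_iff n ‹_›).1 hn
    exact ih (hasProjectiveDimensionLT_of_iso e (n + 1))

section Verdier

open Pretriangulated ZeroObject

variable {C : Type*} [Category C] [HasZeroObject C] [HasShift C ℤ] [Preadditive C]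
    [∀ n : ℤ, (shiftFunctor C n).Additive] [Pretriangulated C] [IsTriangulated C]

lemma isZero_Q_obj_of_prop (W : ObjectProperty C) [W.IsTriangulated] {X : C} (hX : W X) :
    IsZero (W.trW.Q.obj X) := by
  have trW_zero : W.trW (0 : 0 ⟶ X) :=
    ObjectProperty.trW.mk _ (contractible_distinguished₁ X) hX
  have := Localization.inverts W.trW.Q W.trW _ trW_zero
  exact IsZero.of_iso (W.trW.Q.map_isZero (isZero_zero C)) (asIso (W.trW.Q.map (0 : 0 ⟶ X))).symm

lemma prop_of_isZero_Q_obj (W : ObjectProperty C) [W.IsTriangulated] [W.IsStableUnderRetracts]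
    {X : C} (hX : IsZero (W.trW.Q.obj X)) : W X := by
  obtain ⟨Y, s, hs, hs_comp⟩ := (MorphismProperty.map_eq_iff_postcomp W.trW.Q W.trW (𝟙 X) 0).1
    (hX.eq_of_src _ _)
  obtain rfl : s = 0 := by simpa only [Category.id_comp, zero_comp] using hs_comp
  -- The cone of the zero morphism `X ⟶ Y` has `X⟦1⟧` as a retract.
  obtain ⟨Z, g, δ, hT, hZ⟩ := (W.trW_iff _).1 hs
  obtain ⟨r, hr⟩ := Triangle.coyoneda_exact₁ _ hT (𝟙 (X⟦(1 : ℤ)⟧))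
    ((congrArg (_ ≫ ·) ((shiftFunctor C (1 : ℤ)).map_zero X Y)).trans comp_zero)
  have prop_shift : W (X⟦(1 : ℤ)⟧) := W.prop_of_retract ⟨r, δ, hr.symm⟩ hZ
  exact W.prop_of_iso ((shiftEquiv C (1 : ℤ)).unitIso.symm.app X) (W.le_shift (-1) _ prop_shift)

end Verdier

section SingularityCategory

variable {R : CommRingCat.{0}} [IsNoetherianRing R]

/-- Isomorphic coherent sheaves have isomorphic images in the singularity category. -/
def inDSgIso {G H : Coh R} (e : G ≅ H) : inDSg G ≅ inDSg H :=
  (isPerfect R).triangEnvelope.trW.Q.mapIso (X := inDb G) (Y := inDb H)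
    (DerivedCategory.Bounded.ι.preimageIso ((DerivedCategory.singleFunctor (Coh R) 0).mapIso e))

lemma isZero_inDSg_of_isPerfect {G : Coh R} (hG : isPerfect R (inDb G)) : IsZero (inDSg G) :=
  isZero_Q_obj_of_prop _ ((isPerfect R).le_triangEnvelope _ hG)

lemma isPerfect_le_finiteProjectiveDimension : isPerfect R ≤
    (finiteProjectiveDimension (Coh R)).inverseImage DerivedCategory.Bounded.ι := by
  rintro K ⟨P, ⟨a, b, _, _⟩, hP, ⟨e⟩⟩
  exact (finiteProjectiveDimension (Coh R)).prop_of_iso e.symm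
    (finiteProjectiveDimension_Q_obj P a b fun n ↦ projective_of_isLocallyFree _ (hP n))

instance : ((finiteProjectiveDimension (Coh R)).inverseImage
    DerivedCategory.Bounded.ι).IsStableUnderRetracts where
  of_retract r h :=
    (finiteProjectiveDimension (Coh R)).prop_of_retract (r.map DerivedCategory.Bounded.ι) h

lemma exists_hasProjectiveDimensionLT_of_isZero_inDSg {G : Coh R} (hG : IsZero (inDSg G)) :
    ∃ n, HasProjectiveDimensionLT G n :=
  exists_hasProjectiveDimensionLT <|
    (isPerfect R).triangEnvelope_le_iff.2 isPerfect_le_finiteProjectiveDimension _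
      (prop_of_isZero_Q_obj (isPerfect R).triangEnvelope hG)

lemma projective_of_isZero_inDSg {M N : Type} [AddCommGroup M] [Module R M] [Module.Finite R M]
    [AddCommGroup N] [Module R N] [Module.Finite R N] [Module.Projective R N] {f : M →ₗ[R] N}
    {g : N →ₗ[R] M} (hf : Function.Injective f) (hg : Function.Surjective g)
    (hfg : Function.Exact f g) (hM : IsZero (inDSg (cohOf R M))) : Module.Projective R M := by
  obtain ⟨n, _⟩ := exists_hasProjectiveDimensionLT_of_isZero_inDSg hM
  have : Projective (cohOf R N) := projective_cohOf N
  have : Projective (cohOf R M) :=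
    projective_of_hasProjectiveDimensionLT (shortExact_cohMap hf hg hfg) (Iso.refl _)
      (hasProjectiveDimensionLT_of_ge _ n (n + 1) n.le_succ)
  exact projective_of_projective_cohOf M

lemma isPerfect_of_isLocallyFree {G : Coh R} (hG : SheafOfModules.IsLocallyFree G.obj) :
    isPerfect R (inDb G) := by
  refine ⟨(CochainComplex.singleFunctor (Coh R) 0).obj G, ⟨0, 0, inferInstance, inferInstance⟩,
    fun n ↦ ?_, ⟨(DerivedCategory.singleFunctorIsoCompQ (Coh R) 0).app G⟩⟩
  by_cases hn : n = 0
  · subst hn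
    exact isLocallyFree_of_iso ((isCoherent (Spec R)).ι.mapIso
      (HomologicalComplex.singleObjXSelf (.up ℤ) 0 G).symm) hG
  · obtain ⟨Z, isZero_Z, hZ⟩ := exists_isZero_isLocallyFree R
    exact isLocallyFree_of_iso ((isCoherent (Spec R)).ι.mapIso
      (isZero_Z.iso (HomologicalComplex.isZero_single_obj_X (.up ℤ) 0 G n hn))) hZ

lemma isPerfect_cohOf_self : isPerfect R (inDb (cohOf R R)) := by
  let free : (Spec R).Modules := SheafOfModules.free PUnit.{1}
  have isLocallyFree_free : SheafOfModules.IsLocallyFree free :=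
    inferInstanceAs (SheafOfModules.free (R := (Spec R).ringCatSheaf) PUnit.{1}).IsLocallyFree
  let tilde_iso : (tilde.functor R).obj (ModuleCat.of R (PUnit.{1} →₀ R)) ≅ free :=
    tildeFinsupp PUnit.{1}
  let unique_iso : ModuleCat.of R (PUnit.{1} →₀ R) ≅ ModuleCat.of R R :=
    (Finsupp.uniqueLinearEquiv R R PUnit.unit.{1}).toModuleIso
  exact isPerfect_of_isLocallyFree
    (isLocallyFree_of_iso (tilde_iso.symm ≪≫ (tilde.functor R).mapIso unique_iso)
      isLocallyFree_free)

end SingularityCategory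

section Generation

lemma Generates.of_iso {C : Type*} [Category C] [HasZeroObject C] [HasShift C ℤ] [Preadditive C]
    [∀ n : ℤ, (shiftFunctor C n).Additive] [Pretriangulated C] {X Y : C} (hX : Generates X)
    (e : X ≅ Y) : Generates Y :=
  fun T hT _ hY ↦ hX T hT ‹_› (T.prop_of_iso e.symm hY)

variable {R : CommRingCat.{0}} [IsNoetherianRing R]
  (W : ObjectProperty (DerivedCategory (Coh R))) [W.IsTriangulated] [W.IsClosedUnderIsomorphisms]

lemma isDevissage_of_isTriangulated : IsDevissage (R := R) fun N _ _ _ ↦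
    W ((DerivedCategory.singleFunctor (Coh R) 0).obj (cohOf R N)) where
  of_subsingleton N _ _ _ _ := by
    refine W.prop_of_isZero ((DerivedCategory.singleFunctor (Coh R) 0).map_isZero
      ((tildeFG R).map_isZero ((IsZero.iff_id_eq_zero _).2 (FGModuleCat.hom_ext ?_))))
    exact LinearMap.ext fun n ↦ Subsingleton.elim (α := N) _ _
  middle hf hg hfg := W.ext_of_isTriangulatedClosed₂ _
    (shortExact_cohMap hf hg hfg).singleTriangle_distinguished
  right hf hg hfg := W.ext_of_isTriangulatedClosed₃ _
    (shortExact_cohMap hf hg hfg).singleTriangle_distinguished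

lemma prop_obj_of_forall_cohOf
    (hW : ∀ (N : Type) [AddCommGroup N] [Module R N] [Module.Finite R N],
      W ((DerivedCategory.singleFunctor (Coh R) 0).obj (cohOf R N)))
    (K : Db R) : W K.obj := by
  refine prop_of_bounded W (fun G ↦ ?_) K.obj K.property
  let N := (tildeFG R).objPreimage G
  exact W.prop_of_iso ((DerivedCategory.singleFunctor (Coh R) 0).mapIso
    ((tildeFG R).objObjPreimageIso G)) (@hW N _ _ N.property)

lemma generates_of_forall_isDevissage (M : Type) [AddCommGroup M] [Module R M] [Module.Finite R M]
    (hM : ∀ Θ : (N : Type) → [AddCommGroup N] → [Module R N] → [Module.Finite R N] → Prop,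
      IsDevissage Θ → Θ R → Θ M →
        ∀ (N : Type) [AddCommGroup N] [Module R N] [Module.Finite R N], Θ N) :
    Generates (inDSg (cohOf R M)) := by
  intro T _ _ prop_M
  let q : Db R ⥤ DSg R := (isPerfect R).triangEnvelope.trW.Q
  let T' : ObjectProperty (Db R) := T.inverseImage q
  have : T'.IsTriangulated := inferInstanceAs (T.inverseImage q).IsTriangulated
  let W : ObjectProperty (DerivedCategory (Coh R)) := T'.map DerivedCategory.Bounded.ι
  have prop_obj {K : Db R} (hK : T (q.obj K)) : W K.obj :=
    ObjectProperty.prop_map_obj _ DerivedCategory.Bounded.ι hK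
  have prop_R : T (inDSg (cohOf R R)) :=
    T.prop_of_isZero (isZero_inDSg_of_isPerfect isPerfect_cohOf_self)
  have forall_cohOf := hM _ (isDevissage_of_isTriangulated W) (prop_obj prop_R) (prop_obj prop_M)
  refine top_unique fun X _ ↦ ?_
  obtain ⟨K, hK, ⟨e⟩⟩ := (ObjectProperty.prop_map_iff _ _ _).1
    (prop_obj_of_forall_cohOf W forall_cohOf (q.objPreimage X))
  exact T.prop_of_iso
    (q.mapIso (DerivedCategory.Bounded.ι.preimageIso e) ≪≫ q.objObjPreimageIso X) hK

end Generation

/-- `F` is the coherent sheaf associated with the ideal `(x, y)`. -/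
def cohOfRulingIso : cohOf (CommRingCat.of A) ruling ≅ ⟨F, isCoherent_F⟩ :=
  (isCoherent X₂).isoMk tildeRulingIso

lemma not_isZero_inDSg_F : ¬ IsZero (inDSg (R := .of A) ⟨F, isCoherent_F⟩) := by
  intro hF
  obtain ⟨i, hi, hi_exact⟩ := exists_injective_exact_of_exact exact_factorization
    exact_factorization_rulingCover rulingCover_surjective
  exact not_projective_ruling (projective_of_isZero_inDSg (R := .of A) hi rulingCover_surjective
    hi_exact (hF.of_iso (inDSgIso cohOfRulingIso)))

lemma generates_F : Generates (inDSg (R := .of A) ⟨F, isCoherent_F⟩) :=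
  (generates_of_forall_isDevissage (R := .of A) ruling fun _ ↦
    IsDevissage.of_free_of_ruling).of_iso (inDSgIso cohOfRulingIso)

end

end A1Singularity

theorem mainTheorem5 :
    ∃ hF : A1Singularity.isCoherent A1Singularity.X₂ A1Singularity.F,
      A1Singularity.rank A1Singularity.F = 1 ∧
      (∃ (ε : A1Singularity.O₂ ⟶ A1Singularity.F) (h₀ : A1Singularity.φ ≫ ε = 0)
          (h₁ : A1Singularity.φ ≫ A1Singularity.φ = 0),
        Epi ε ∧ (ShortComplex.mk A1Singularity.φ ε h₀).Exact ∧
          (ShortComplex.mk A1Singularity.φ A1Singularity.φ h₁).Exact) ∧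
      ¬ A1Singularity.isPerfect (.of A1Singularity.A)
          (A1Singularity.inDb ⟨A1Singularity.F, hF⟩) ∧
      ¬ IsZero (A1Singularity.inDSg (R := .of A1Singularity.A) ⟨A1Singularity.F, hF⟩) ∧
      A1Singularity.Generates
        (A1Singularity.inDSg (R := .of A1Singularity.A) ⟨A1Singularity.F, hF⟩) :=
  ⟨A1Singularity.isCoherent_F, A1Singularity.rank_F, A1Singularity.exists_resolution_F,
    fun h ↦ A1Singularity.not_isZero_inDSg_F (A1Singularity.isZero_inDSg_of_isPerfect h),
    A1Singularity.not_isZero_inDSg_F, A1Singularity.generates_F⟩
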